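/- **Setting.** A static spacetime has metric $-\lambda\,dt^2+\lambda^{-1}h$, where $\xi=\partial_t$ is the static Killing vector, $\lambda=-\xi^a\xi_a>0$ and $h=\lambda g+\xi\otimes\xi$ is the induced Riemannian metric on the 3-manifold $V$ of trajectories of $\xi$. It is asymptotically flat: there are a smooth 3-manifold $\widetilde V=V\cup\{\Lambda\}$, with $\Lambda$ a single point, and a smooth function $\Omega$ on $\widetilde V$, positive on $V$, such that $\tilde h=\Omega^2h$ extends to a smooth Riemannian metric on $\widetilde V$ and, at $\Lambda$, $\Omega=0$, $\tilde D_a\Omega=0$, $\tilde D_a\tilde D_b\Omega=2\tilde h_{ab}$, where $\tilde D$ is the Levi-Civita connection of $\tilde h$. It is axisymmetric: there is a nontrivial smooth action of the circle group on $\widetilde V$ that fixes $\Lambda$ and preserves $\lambda$ and $h$. For a potential $\phi$ on $V$ such that $\tilde\phi=\phi/\sqrt\Omega$ extends smoothly to $\Lambda$, define tensor fields on $\widetilde V$ by $P=\tilde\phi$ and, for $n\ge1$, $$P_{a_1\ldots a_n}=C\Big[\tilde D_{a_1}P_{a_2\ldots a_n}-\tfrac{(n-1)(2n-3)}{2}\,\widetilde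 R_{a_1a_2}P_{a_3\ldots a_n}\Big]$$ (the second term is absent for $n=1$), where $\widetilde R_{ab}$ is the Ricci tensor of $\tilde h$ and $C[\,\cdot\,]$ denotes the totally symmetric and trace-free part with respect to $\tilde h$. The multipole moments produced by $\phi$ are the tensors $P_{a_1\ldots a_n}(\Lambda)$, $n=0,1,2,\ldots$. **Theorem.** Suppose that a static, axisymmetric, asymptotically flat spacetime as above satisfies the vacuum Einstein equations. Let $$\phi_H=\frac{1-\lambda^2}{4\lambda},\qquad \phi_G=\lambda^{-1/4}\,(1-\sqrt\lambda)$$ be the Hansen and the Geroch potential. Then $\phi_H/\sqrt\Omega$ extends smoothly to $\Lambda$ if and only if $\phi_G/\sqrt\Omega$ does, and in this case the two potentials produce the same multipole moments: for every $n\ge0$ the tensors $P_{a_1\ldots a_n}(\Lambda)$ obtained from $\phi_H$ and from $\phi_G$ are equal. -/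

import Mathlib

open scoped Manifold ContDiff

noncomputable section

namespace Multipole

/-! ### Tensor calculus in coordinates

Metrics on (open subsets of) `ℝ^ι` are given by their matrices of components; a covariant tensor
of rank `n` is given by its components, indexed by `Fin n → ι`. -/

section Coordinates

variable {ι : Type} [Fintype ι] [DecidableEq ι]

/-- The partial derivative `∂_i f` at `x`. -/
def pderiv (i : ι) (f : EuclideanSpace ℝ ι → ℝ) (x : EuclideanSpace ℝ ι) : ℝ :=
  fderiv ℝ f x (EuclideanSpace.single i 1)

/-- The Christoffel symbols `Γ^k_{ij}` of the Levi-Civita connection of `g`. -/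
def christoffel (g : EuclideanSpace ℝ ι → Matrix ι ι ℝ) (k i j : ι)
    (x : EuclideanSpace ℝ ι) : ℝ :=
  (1 / 2) * ∑ l, (g x)⁻¹ k l *
    (pderiv i (fun y => g y j l) x + pderiv j (fun y => g y i l) x - pderiv l (fun y => g y i j) x)

/-- The Ricci tensor
`R_{ij} = ∂_k Γ^k_{ij} - ∂_j Γ^k_{ik} + Γ^k_{kl} Γ^l_{ij} - Γ^k_{jl} Γ^l_{ik}`. -/
def ricci (g : EuclideanSpace ℝ ι → Matrix ι ι ℝ) (x : EuclideanSpace ℝ ι) (i j : ι) : ℝ :=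
  ∑ k, (pderiv k (christoffel g k i j) x - pderiv j (christoffel g k i k) x) +
    ∑ k, ∑ l, (christoffel g k k l x * christoffel g l i j x -
      christoffel g k j l x * christoffel g l i k x)

/-- The covariant derivative `D_{a_0} T_{a_1 … a_n}` of a covariant tensor field; the
differentiation index comes first. -/
def covDeriv (g : EuclideanSpace ℝ ι → Matrix ι ι ℝ) {n : ℕ}
    (T : EuclideanSpace ℝ ι → (Fin n → ι) → ℝ) (x : EuclideanSpace ℝ ι)
    (I : Fin (n + 1) → ι) : ℝ :=
  pderiv (I 0) (fun y => T y (Fin.tail I)) x -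
    ∑ k : Fin n, ∑ c, christoffel g c (I 0) (Fin.tail I k) x *
      T x (Function.update (Fin.tail I) k c)

/-- Total symmetry and vanishing of all traces with respect to the metric `H`. -/
structure IsSTF (H : Matrix ι ι ℝ) {n : ℕ} (T : (Fin n → ι) → ℝ) : Prop where
  symm : ∀ (σ : Equiv.Perm (Fin n)) (I : Fin n → ι), T (I ∘ σ) = T I
  traceFree : ∀ k l : Fin n, k ≠ l → ∀ I : Fin n → ι,
    ∑ a, ∑ b, H⁻¹ a b * T (Function.update (Function.update I k a) l b) = 0

/-- The inner product `H^{a_1 b_1} ⋯ H^{a_n b_n} S_{a_1 … a_n} T_{b_1 … b_n}` of tensors. -/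
def tensorInner (H : Matrix ι ι ℝ) {n : ℕ} (S T : (Fin n → ι) → ℝ) : ℝ :=
  ∑ I : Fin n → ι, ∑ J : Fin n → ι, (∏ k, H⁻¹ (I k) (J k)) * S I * T J

/-- `S` is the totally symmetric and trace-free part of `T`, that is, the orthogonal projection
of `T` to the space of totally symmetric trace-free tensors. -/
def IsSTFPart (H : Matrix ι ι ℝ) {n : ℕ} (T S : (Fin n → ι) → ℝ) : Prop :=
  IsSTF H S ∧ ∀ X, IsSTF H X → tensorInner H (T - S) X = 0

theorem isSTF_zero (H : Matrix ι ι ℝ) (n : ℕ) : IsSTF H (0 : (Fin n → ι) → ℝ) :=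
  ⟨fun _ _ => rfl, fun _ _ _ _ => by simp⟩

/-- The totally symmetric trace-free tensors form a linear space. -/
def stfSubmodule (H : Matrix ι ι ℝ) (n : ℕ) : Submodule ℝ ((Fin n → ι) → ℝ) where
  carrier := {T | IsSTF H T}
  zero_mem' := isSTF_zero H n
  add_mem' := fun {S T} hS hT =>
    ⟨fun σ I => by simp [hS.symm σ I, hT.symm σ I], fun k l hkl I => by
      simp [mul_add, Finset.sum_add_distrib, hS.traceFree k l hkl I, hT.traceFree k l hkl I]⟩
  smul_mem' := fun c T hT =>
    ⟨fun σ I => by simp [hT.symm σ I], fun k l hkl I => by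
      have h := hT.traceFree k l hkl I
      simp only [Pi.smul_apply, smul_eq_mul, mul_left_comm _ c, ← Finset.mul_sum, h, mul_zero]⟩

open scoped MatrixOrder Matrix.Norms.L2Operator in
theorem eq_zero_of_tensorInner_self_nonpos {H : Matrix ι ι ℝ} (hH : H.PosDef) {n : ℕ}
    {T : (Fin n → ι) → ℝ} (hT : tensorInner H T T ≤ 0) : T = 0 := by
  obtain ⟨B, hB, hBH⟩ : ∃ B : Matrix ι ι ℝ, IsUnit B ∧ H⁻¹ = B.transpose * B := by
    obtain ⟨B, hB, h⟩ := CStarAlgebra.isStrictlyPositive_iff_eq_star_mul_self.mp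
      hH.inv.isStrictlyPositive
    exact ⟨B, hB, by rw [h, Matrix.star_eq_conjTranspose, Matrix.conjTranspose_eq_transpose_of_trivial]⟩
  have key : tensorInner H T T = ∑ K : Fin n → ι, (∑ I, (∏ k, B (K k) (I k)) * T I) ^ 2 := by
    have e1 : ∀ I J : Fin n → ι, (∏ k, H⁻¹ (I k) (J k)) =
        ∑ K : Fin n → ι, (∏ k, B (K k) (I k)) * ∏ k, B (K k) (J k) := by
      intro I J
      simp only [hBH, Matrix.mul_apply, Matrix.transpose_apply, ← Finset.prod_mul_distrib]
      rw [Finset.prod_univ_sum, Fintype.piFinset_univ]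
    simp only [tensorInner, e1, sq, Finset.sum_mul]
    conv_lhs => enter [2, I]; rw [Finset.sum_comm]
    rw [Finset.sum_comm]
    refine Finset.sum_congr rfl fun K _ => Finset.sum_congr rfl fun I _ => ?_
    rw [Finset.mul_sum]
    exact Finset.sum_congr rfl fun J _ => by ring
  have hz : ∀ K : Fin n → ι, ∑ I, (∏ k, B (K k) (I k)) * T I = 0 := by
    have h0 := (Finset.sum_eq_zero_iff_of_nonneg
      (fun (K : Fin n → ι) _ => sq_nonneg (∑ I, (∏ k, B (K k) (I k)) * T I))).mp
      (le_antisymm (key ▸ hT) (Finset.sum_nonneg fun _ _ => sq_nonneg _))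
    intro K
    exact pow_eq_zero_iff two_ne_zero |>.mp (h0 K (Finset.mem_univ K))
  have hinv : B⁻¹ * B = 1 := Matrix.nonsing_inv_mul B ((Matrix.isUnit_iff_isUnit_det B).mp hB)
  funext J
  have e2 : ∀ I : Fin n → ι, ∑ K : Fin n → ι, (∏ k, B⁻¹ (J k) (K k)) * ∏ k, B (K k) (I k) =
      if J = I then 1 else 0 := by
    intro I
    have h1 : ∏ k, (B⁻¹ * B) (J k) (I k) =
        ∑ K : Fin n → ι, (∏ k, B⁻¹ (J k) (K k)) * ∏ k, B (K k) (I k) := by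
      simp only [Matrix.mul_apply, ← Finset.prod_mul_distrib]
      rw [Finset.prod_univ_sum, Fintype.piFinset_univ]
    rw [← h1, hinv]
    simp only [Matrix.one_apply, Finset.prod_ite_zero, Finset.prod_const_one, Finset.mem_univ,
      true_implies, funext_iff]
  have h2 : ∑ K : Fin n → ι, (∏ k, B⁻¹ (J k) (K k)) * ∑ I, (∏ k, B (K k) (I k)) * T I = T J := by
    simp only [Finset.mul_sum, ← mul_assoc]
    rw [Finset.sum_comm]
    simp only [← Finset.sum_mul, e2, ite_mul, one_mul, zero_mul, Finset.sum_ite_eq,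
      Finset.mem_univ, if_true]
  rw [← h2]
  simp [hz]

/-- For a positive definite metric the totally symmetric and trace-free part exists and is
unique. -/
theorem existsUnique_isSTFPart {H : Matrix ι ι ℝ} (hH : H.PosDef) {n : ℕ}
    (T : (Fin n → ι) → ℝ) : ∃! S, IsSTFPart H T S := by
  let F : ((Fin n → ι) → ℝ) →ₗ[ℝ] Module.Dual ℝ (stfSubmodule H n) :=
    LinearMap.mk₂ ℝ (fun S (X : stfSubmodule H n) => tensorInner H S X)
      (fun S S' X => by simp [tensorInner, mul_add, add_mul, Finset.sum_add_distrib])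
      (fun c S X => by
        simp only [tensorInner, Pi.smul_apply, smul_eq_mul, Finset.mul_sum]
        exact Finset.sum_congr rfl fun _ _ => Finset.sum_congr rfl fun _ _ => by ring)
      (fun S X X' => by simp [tensorInner, mul_add, Finset.sum_add_distrib])
      (fun c S X => by
        simp only [tensorInner, Submodule.coe_smul, Pi.smul_apply, smul_eq_mul, Finset.mul_sum]
        exact Finset.sum_congr rfl fun _ _ => Finset.sum_congr rfl fun _ _ => by ring)
  have hF : ∀ S (X : stfSubmodule H n), F S X = tensorInner H S X := fun _ _ => rfl
  have hinj : Function.Injective (F.comp (stfSubmodule H n).subtype) := by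
    rw [← LinearMap.ker_eq_bot, LinearMap.ker_eq_bot']
    intro X hX
    have h := LinearMap.congr_fun hX X
    exact Subtype.ext (eq_zero_of_tensorInner_self_nonpos hH (le_of_eq h))
  have hsurj := (LinearMap.injective_iff_surjective_of_finrank_eq_finrank
    (Subspace.dual_finrank_eq (K := ℝ) (V := stfSubmodule H n)).symm).mp hinj
  have hiff : ∀ S : stfSubmodule H n, IsSTFPart H T S ↔
      F.comp (stfSubmodule H n).subtype S = F T := by
    intro S
    have hsub : ∀ X : stfSubmodule H n,
        tensorInner H (T - (S : (Fin n → ι) → ℝ)) X = F T X - F S X := fun X => by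
      rw [← hF, map_sub, LinearMap.sub_apply]
    constructor
    · intro h
      ext X
      have := h.2 X X.2
      rw [hsub] at this
      exact (sub_eq_zero.mp this).symm
    · intro h
      refine ⟨S.2, fun X hX => ?_⟩
      rw [hsub ⟨X, hX⟩, ← h]
      exact sub_self _
  obtain ⟨S, hS⟩ := hsurj (F T)
  refine ⟨S, (hiff S).mpr hS, fun S' hS' => ?_⟩
  have := (hiff ⟨S', hS'.1⟩).mp hS'
  exact congrArg Subtype.val (hinj (this.trans hS.symm))

open Classical in
/-- `C[T]`, the totally symmetric and trace-free part of `T`. By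
`existsUnique_isSTFPart` it is characterized by `IsSTFPart`; the value `0` in the other case is
never used for a (positive definite) metric. -/
def stfPart (H : Matrix ι ι ℝ) {n : ℕ} (T : (Fin n → ι) → ℝ) : (Fin n → ι) → ℝ :=
  if h : ∃ S, IsSTFPart H T S then h.choose else 0

/-- The Geroch–Hansen recursion: `P = φ`, `P_a = C[D_a P]` and
`P_{a_1 … a_n} = C[D_{a_1} P_{a_2 … a_n} - ((n-1)(2n-3)/2) R_{a_1 a_2} P_{a_3 … a_n}]`
for `n ≥ 2` (written below with `n + 2` in place of `n`). -/
def multipoleTensor (g : EuclideanSpace ℝ ι → Matrix ι ι ℝ) (φ : EuclideanSpace ℝ ι → ℝ) :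
    (n : ℕ) → EuclideanSpace ℝ ι → (Fin n → ι) → ℝ
  | 0 => fun x _ => φ x
  | 1 => fun x => stfPart (g x) (covDeriv g (multipoleTensor g φ 0) x)
  | n + 2 => fun x => stfPart (g x) fun I =>
      covDeriv g (multipoleTensor g φ (n + 1)) x I -
        ((n + 1 : ℝ) * (2 * n + 1) / 2) *
          (ricci g x (I 0) (I 1) * multipoleTensor g φ n x (Fin.tail (Fin.tail I)))

end Coordinates

/-- The components, in coordinates `(t, x)` on `ℝ × ℝ³`, of the static metric
`-λ dt² + λ⁻¹ h_{ij} dx^i dx^j`. -/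
def staticMetric (lam : EuclideanSpace ℝ (Fin 3) → ℝ)
    (h : EuclideanSpace ℝ (Fin 3) → Matrix (Fin 3) (Fin 3) ℝ)
    (y : EuclideanSpace ℝ (Fin 4)) : Matrix (Fin 4) (Fin 4) ℝ :=
  let x : EuclideanSpace ℝ (Fin 3) := WithLp.toLp 2 fun i => y i.succ
  Matrix.of fun a b =>
    Fin.cases (Fin.cases (-lam x) (fun _ => 0) b)
      (fun i => Fin.cases 0 (fun j => (lam x)⁻¹ * h x i j) b) a

/-! ### Static asymptotically flat spacetimes -/

variable {Vt : Type*} [TopologicalSpace Vt] [ChartedSpace (EuclideanSpace ℝ (Fin 3)) Vt]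

/-- The components, in a chart `e`, of a field of bilinear forms on tangent spaces. -/
def chartComponents
    (B : ∀ p : Vt, TangentSpace (𝓡 3) p → TangentSpace (𝓡 3) p → ℝ)
    (e : OpenPartialHomeomorph Vt (EuclideanSpace ℝ (Fin 3)))
    (x : EuclideanSpace ℝ (Fin 3)) : Matrix (Fin 3) (Fin 3) ℝ :=
  Matrix.of fun i j =>
    B (e.symm x)
      (mfderiv (𝓡 3) (𝓡 3) e.symm x (EuclideanSpace.single i (1 : ℝ) : EuclideanSpace ℝ (Fin 3)))
      (mfderiv (𝓡 3) (𝓡 3) e.symm x (EuclideanSpace.single j (1 : ℝ) : EuclideanSpace ℝ (Fin 3)))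

variable (Vt) in
/-- A static asymptotically flat spacetime, described on the one-point conformal
compactification `Vt = V ∪ {Λ}` of the 3-manifold `V` of trajectories of the static Killing
vector `ξ = ∂_t`. The data are the function `lam = -ξ^a ξ_a > 0` on `V` (its value at `Λ` plays no
role), the smooth metric `h̃` on `Vt` and the conformal factor `Ω`. The metric on `V` is
`h = Ω⁻² h̃`, and the spacetime metric is `-lam dt² + lam⁻¹ h`. -/
structure StaticAF [IsManifold (𝓡 3) ∞ Vt] where
  /-- the point at infinity -/
  Λ : Vt
  lam : Vt → ℝ
  lam_pos : ∀ p, p ≠ Λ → 0 < lam p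
  lam_smooth : ContMDiffOn (𝓡 3) 𝓘(ℝ, ℝ) ∞ lam {Λ}ᶜ
  /-- the rescaled metric `h̃ = Ω² h` -/
  ht : Bundle.ContMDiffRiemannianMetric (𝓡 3) ∞ (EuclideanSpace ℝ (Fin 3))
    (fun p : Vt => TangentSpace (𝓡 3) p)
  /-- the conformal factor -/
  Ω : Vt → ℝ
  Ω_smooth : ContMDiff (𝓡 3) 𝓘(ℝ, ℝ) ∞ Ω
  Ω_pos : ∀ p, p ≠ Λ → 0 < Ω p
  Ω_zero : Ω Λ = 0
  /-- `D̃_a Ω = 0` at `Λ` -/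
  Ω_grad : ∀ e ∈ IsManifold.maximalAtlas (𝓡 3) ∞ Vt, Λ ∈ e.source → ∀ i : Fin 3,
    pderiv i (Ω ∘ e.symm) (e Λ) = 0
  /-- `D̃_a D̃_b Ω = 2 h̃_{ab}` at `Λ` -/
  Ω_hess : ∀ e ∈ IsManifold.maximalAtlas (𝓡 3) ∞ Vt, Λ ∈ e.source → ∀ i j : Fin 3,
    pderiv i (pderiv j (Ω ∘ e.symm)) (e Λ) -
        ∑ k, christoffel (chartComponents (fun p v w => ht.inner p v w) e) k i j (e Λ) *
          pderiv k (Ω ∘ e.symm) (e Λ) =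
      2 * chartComponents (fun p v w => ht.inner p v w) e (e Λ) i j

namespace StaticAF

variable [IsManifold (𝓡 3) ∞ Vt] (S : StaticAF Vt)

/-- The components of `h̃` in a chart. -/
def htChart (e : OpenPartialHomeomorph Vt (EuclideanSpace ℝ (Fin 3))) :
    EuclideanSpace ℝ (Fin 3) → Matrix (Fin 3) (Fin 3) ℝ :=
  chartComponents (fun p v w => S.ht.inner p v w) e

/-- The metric `h = Ω⁻² h̃` on `V`. -/
def h (p : Vt) (v w : TangentSpace (𝓡 3) p) : ℝ := (S.Ω p ^ 2)⁻¹ * S.ht.inner p v w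

/-- The spacetime metric `-lam dt² + lam⁻¹ h` is Ricci flat. -/
def IsVacuum : Prop :=
  ∀ e ∈ IsManifold.maximalAtlas (𝓡 3) ∞ Vt, ∀ y : EuclideanSpace ℝ (Fin 4),
    ∀ x : EuclideanSpace ℝ (Fin 3), (∀ i : Fin 3, x i = y i.succ) →
      x ∈ e.target → e.symm x ≠ S.Λ → ∀ a b : Fin 4,
        ricci (staticMetric (S.lam ∘ e.symm) (chartComponents S.h e)) y a b = 0

/-- Axisymmetry: a nontrivial smooth action of the rotation group `ℝ / 2πℤ` which fixes `Λ` and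
preserves `lam` and `h`, and hence the spacetime metric. -/
def IsAxisymmetric : Prop :=
  ∃ R : ℝ → Vt → Vt,
    ContMDiff (𝓘(ℝ, ℝ).prod (𝓡 3)) (𝓡 3) ∞ (fun q : ℝ × Vt => R q.1 q.2) ∧
    (∀ p, R 0 p = p) ∧
    (∀ s t p, R (s + t) p = R s (R t p)) ∧
    (∀ p, R (2 * Real.pi) p = p) ∧
    (∃ s p, R s p ≠ p) ∧
    (∀ s, R s S.Λ = S.Λ) ∧
    (∀ s p, p ≠ S.Λ → S.lam (R s p) = S.lam p) ∧
    (∀ s p, p ≠ S.Λ → ∀ v w : TangentSpace (𝓡 3) p,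
      S.h (R s p) (mfderiv (𝓡 3) (𝓡 3) (R s) p v) (mfderiv (𝓡 3) (𝓡 3) (R s) p w) = S.h p v w)

/-- The Hansen potential of a static spacetime. -/
def hansen (p : Vt) : ℝ := (1 - S.lam p ^ 2) / (4 * S.lam p)

/-- The Geroch potential. -/
def geroch (p : Vt) : ℝ := S.lam p ^ (-(1 / 4) : ℝ) * (1 - √(S.lam p))

/-- `φt` is the rescaled potential `φ̃ = φ / √Ω`, smoothly extended to `Λ`. -/
def IsRescaled (φ φt : Vt → ℝ) : Prop :=
  ContMDiff (𝓡 3) 𝓘(ℝ, ℝ) ∞ φt ∧ ∀ p, p ≠ S.Λ → φt p = φ p / √(S.Ω p)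

/-- The components, in a chart around `Λ`, of the `n`-th multipole moment `P_{a_1 … a_n}(Λ)`
which is produced by the rescaled potential `φt`. -/
def moment (φt : Vt → ℝ) (e : OpenPartialHomeomorph Vt (EuclideanSpace ℝ (Fin 3))) (n : ℕ) :
    (Fin n → Fin 3) → ℝ :=
  multipoleTensor (S.htChart e) (φt ∘ e.symm) n (e S.Λ)

end StaticAF

end Multipole

end

/-!
Contracting all indices of a tensor with a tangent vector `v` turns it into a function on the
tangent bundle. Covariant differentiation then becomes differentiation along the geodesic spray, and
modulo multiples of `g(v, v)` the projection to the symmetric trace-free part disappears from the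
recursion. By the vacuum equations, the Hessian of the conformal factor `Ω` lies in the ideal of
smooth functions on the tangent bundle that is generated by `Ω`, `dΩ` and `g`, so this ideal is
stable under the spray.

The two potentials satisfy `φ_H = φ_G √(1 + φ_G² / 4) (1 + φ_G² / 2)`, and `φ_G² = Ω φ̃_G²`, so
`φ̃_H - φ̃_G` is a multiple of `Ω`. By induction, the contracted differences of all the tensors
`P_{a_1 … a_n}` lie in the ideal. At `Λ`, where `Ω` and `dΩ` vanish, such a difference is thus a
trace-free tensor whose polynomial is divisible by the metric, and hence zero.
-/

noncomputable section

namespace Multipole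

local notation "𝔼" => EuclideanSpace ℝ

/-! ### Partial derivatives -/

section Calculus

theorem differentiableAt_of_contDiffOn {E F : Type*} [NormedAddCommGroup E] [NormedSpace ℝ E]
    [NormedAddCommGroup F] [NormedSpace ℝ F] {s : Set E} {f : E → F} {x : E} (hs : IsOpen s)
    (hf : ContDiffOn ℝ ∞ f s) (hx : x ∈ s) : DifferentiableAt ℝ f x :=
  (hf.contDiffAt (hs.mem_nhds hx)).differentiableAt (by simp)

theorem contDiffOn_matrix_det {E κ : Type*} [NormedAddCommGroup E] [NormedSpace ℝ E] [Fintype κ]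
    [DecidableEq κ] {n : WithTop ℕ∞} {s : Set E} {A : E → Matrix κ κ ℝ}
    (hA : ∀ i j, ContDiffOn ℝ n (fun x => A x i j) s) :
    ContDiffOn ℝ n (fun x => (A x).det) s := by
  simp only [Matrix.det_apply']
  exact ContDiffOn.sum fun σ _ => contDiffOn_const.mul (contDiffOn_prod fun i _ => hA _ _)

theorem contDiffOn_matrix_inv {E κ : Type*} [NormedAddCommGroup E] [NormedSpace ℝ E] [Fintype κ]
    [DecidableEq κ] {n : WithTop ℕ∞} {s : Set E} {A : E → Matrix κ κ ℝ}
    (hA : ∀ i j, ContDiffOn ℝ n (fun x => A x i j) s) (hdet : ∀ x ∈ s, (A x).det ≠ 0) (i j : κ) :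
    ContDiffOn ℝ n (fun x => (A x)⁻¹ i j) s := by
  have cramer : (fun x => (A x)⁻¹ i j) =
      fun x => ((A x).det)⁻¹ * ((A x).updateRow j (Pi.single i 1)).det := by
    funext x
    rw [Matrix.inv_def, Matrix.smul_apply, Matrix.adjugate_apply, Ring.inverse_eq_inv', smul_eq_mul]
  rw [cramer]
  refine ((contDiffOn_matrix_det hA).inv hdet).mul (contDiffOn_matrix_det fun k l => ?_)
  obtain rfl | hk := eq_or_ne k j
  · simpa using contDiffOn_const
  · simpa [Matrix.updateRow_ne hk] using hA k l

variable {ι : Type} [DecidableEq ι] {U : Set (𝔼 ι)} {f f' : 𝔼 ι → ℝ} {x : 𝔼 ι}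

theorem pderiv_congr (hU : IsOpen U) (h : Set.EqOn f f' U) (hx : x ∈ U) (i : ι) :
    pderiv i f x = pderiv i f' x := by
  rw [pderiv, (h.eventuallyEq_of_mem (hU.mem_nhds hx)).fderiv_eq, pderiv]

variable [Fintype ι]

theorem sum_smul_single (v : 𝔼 ι) : ∑ i, v i • EuclideanSpace.single i (1 : ℝ) = v := by
  ext j
  simp [Pi.single_apply]

theorem fderiv_eq_sum_pderiv (f : 𝔼 ι → ℝ) (x v : 𝔼 ι) :
    fderiv ℝ f x v = ∑ i, v i * pderiv i f x := by
  conv_lhs => rw [← sum_smul_single v]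
  simp [pderiv]

theorem contDiffOn_pderiv (hU : IsOpen U) (hf : ContDiffOn ℝ ∞ f U) (i : ι) :
    ContDiffOn ℝ ∞ (pderiv i f) U :=
  (hf.fderiv_of_isOpen hU (by simp)).clm_apply contDiffOn_const

theorem pderiv_add (hf : DifferentiableAt ℝ f x) (hf' : DifferentiableAt ℝ f' x) (i : ι) :
    pderiv i (fun y => f y + f' y) x = pderiv i f x + pderiv i f' x := by
  simp [pderiv, fderiv_fun_add hf hf']

theorem pderiv_sub (hf : DifferentiableAt ℝ f x) (hf' : DifferentiableAt ℝ f' x) (i : ι) :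
    pderiv i (fun y => f y - f' y) x = pderiv i f x - pderiv i f' x := by
  simp [pderiv, fderiv_fun_sub hf hf']

theorem pderiv_mul (hf : DifferentiableAt ℝ f x) (hf' : DifferentiableAt ℝ f' x) (i : ι) :
    pderiv i (fun y => f y * f' y) x = pderiv i f x * f' x + f x * pderiv i f' x := by
  simp [pderiv, fderiv_fun_mul hf hf']
  ring

theorem pderiv_const_mul (hf : DifferentiableAt ℝ f x) (c : ℝ) (i : ι) :
    pderiv i (fun y => c * f y) x = c * pderiv i f x := by
  simp [pderiv, fderiv_const_mul hf c]

theorem pderiv_sum {α : Type*} (s : Finset α) {f : α → 𝔼 ι → ℝ}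
    (hf : ∀ a ∈ s, DifferentiableAt ℝ (f a) x) (i : ι) :
    pderiv i (fun y => ∑ a ∈ s, f a y) x = ∑ a ∈ s, pderiv i (f a) x := by
  simp [pderiv, fderiv_fun_sum hf]

theorem pderiv_comp (hf : DifferentiableAt ℝ f x) {r : ℝ → ℝ} {r' : ℝ}
    (hr : HasDerivAt r r' (f x)) (i : ι) : pderiv i (fun y => r (f y)) x = r' * pderiv i f x := by
  have h : HasFDerivAt (fun y => r (f y)) (r' • fderiv ℝ f x) x :=
    hr.comp_hasFDerivAt x hf.hasFDerivAt
  simp [pderiv, h.fderiv]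

theorem pderiv_comm (hf : ContDiffAt ℝ 2 f x) (i j : ι) :
    pderiv i (pderiv j f) x = pderiv j (pderiv i f) x := by
  have hdf : DifferentiableAt ℝ (fderiv ℝ f) x :=
    (hf.fderiv_right (m := 1) (by norm_num)).differentiableAt one_ne_zero
  have hsymm : IsSymmSndFDerivAt ℝ f x :=
    hf.isSymmSndFDerivAt minSmoothness_of_isRCLikeNormedField.le
  have second_deriv (a b : ι) : pderiv a (pderiv b f) x =
      fderiv ℝ (fderiv ℝ f) x (EuclideanSpace.single a 1) (EuclideanSpace.single b 1) := by
    change fderiv ℝ (fun y => fderiv ℝ f y (EuclideanSpace.single b 1)) x _ = _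
    simp [fderiv_clm_apply hdf (differentiableAt_const _)]
  rw [second_deriv, second_deriv, hsymm]

end Calculus

/-! ### Riemannian metrics in coordinates -/

section Metric

variable {ι : Type} [Fintype ι]

/-- A smooth Riemannian metric on an open set, given by its matrix of components. -/
structure IsSmoothMetricOn (g : 𝔼 ι → Matrix ι ι ℝ) (U : Set (𝔼 ι)) : Prop where
  isOpen : IsOpen U
  smooth : ∀ i j, ContDiffOn ℝ ∞ (fun x => g x i j) U
  posDef : ∀ x ∈ U, (g x).PosDef

namespace IsSmoothMetricOn

variable {U V : Set (𝔼 ι)} {g g' : 𝔼 ι → Matrix ι ι ℝ} {x : 𝔼 ι}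

theorem mono (hg : IsSmoothMetricOn g U) (hV : IsOpen V) (hVU : V ⊆ U) : IsSmoothMetricOn g V where
  isOpen := hV
  smooth i j := (hg.smooth i j).mono hVU
  posDef x hx := hg.posDef x (hVU hx)

theorem congr (hg : IsSmoothMetricOn g U) (h : Set.EqOn g' g U) : IsSmoothMetricOn g' U where
  isOpen := hg.isOpen
  smooth i j := (hg.smooth i j).congr fun y hy => by rw [h hy]
  posDef x hx := h hx ▸ hg.posDef x hx

theorem exp_smul (hg : IsSmoothMetricOn g U) {s : 𝔼 ι → ℝ} (hs : ContDiffOn ℝ ∞ s U) :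
    IsSmoothMetricOn (fun y => Real.exp (2 * s y) • g y) U where
  isOpen := hg.isOpen
  smooth i j := ((contDiffOn_const.mul hs).exp).mul (hg.smooth i j)
  posDef x hx := (hg.posDef x hx).smul (Real.exp_pos _)

theorem symm (hg : IsSmoothMetricOn g U) (hx : x ∈ U) (i j : ι) : g x i j = g x j i := by
  simpa using ((hg.posDef x hx).isHermitian.apply i j).symm

variable [DecidableEq ι]

theorem isUnit_det (hg : IsSmoothMetricOn g U) (hx : x ∈ U) : IsUnit (g x).det :=
  (hg.posDef x hx).det_pos.ne'.isUnit

theorem sum_mul_inv (hg : IsSmoothMetricOn g U) (hx : x ∈ U) (i j : ι) :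
    ∑ k, g x i k * (g x)⁻¹ k j = if i = j then 1 else 0 := by
  rw [← Matrix.mul_apply, Matrix.mul_nonsing_inv _ (hg.isUnit_det hx), Matrix.one_apply]

theorem sum_inv_mul (hg : IsSmoothMetricOn g U) (hx : x ∈ U) (i j : ι) :
    ∑ k, (g x)⁻¹ i k * g x k j = if i = j then 1 else 0 := by
  rw [← Matrix.mul_apply, Matrix.nonsing_inv_mul _ (hg.isUnit_det hx), Matrix.one_apply]

theorem contDiffOn_inv (hg : IsSmoothMetricOn g U) (i j : ι) :
    ContDiffOn ℝ ∞ (fun x => (g x)⁻¹ i j) U :=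
  contDiffOn_matrix_inv hg.smooth (fun _ hx => (hg.isUnit_det hx).ne_zero) i j

theorem contDiffOn_christoffel (hg : IsSmoothMetricOn g U) (k i j : ι) :
    ContDiffOn ℝ ∞ (christoffel g k i j) U := by
  refine contDiffOn_const.mul (ContDiffOn.sum fun l _ => (hg.contDiffOn_inv k l).mul ?_)
  exact ((contDiffOn_pderiv hg.isOpen (hg.smooth j l) i).add
    (contDiffOn_pderiv hg.isOpen (hg.smooth i l) j)).sub
    (contDiffOn_pderiv hg.isOpen (hg.smooth i j) l)

theorem contDiffOn_ricci (hg : IsSmoothMetricOn g U) (i j : ι) :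
    ContDiffOn ℝ ∞ (fun x => ricci g x i j) U := by
  have hΓ := hg.contDiffOn_christoffel
  refine ContDiffOn.add (ContDiffOn.sum fun k _ => ?_)
    (ContDiffOn.sum fun k _ => ContDiffOn.sum fun l _ => ?_)
  · exact (contDiffOn_pderiv hg.isOpen (hΓ k i j) k).sub (contDiffOn_pderiv hg.isOpen (hΓ k i k) j)
  · exact ((hΓ k k l).mul (hΓ l i j)).sub ((hΓ k j l).mul (hΓ l i k))

theorem pderiv_symm (hg : IsSmoothMetricOn g U) (hx : x ∈ U) (k i j : ι) :
    pderiv k (fun y => g y i j) x = pderiv k (fun y => g y j i) x :=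
  pderiv_congr hg.isOpen (fun _ hy => hg.symm hy i j) hx k

theorem christoffel_symm (hg : IsSmoothMetricOn g U) (hx : x ∈ U) (k i j : ι) :
    christoffel g k i j x = christoffel g k j i x := by
  simp only [christoffel, hg.pderiv_symm hx _ j i]
  congr! 3
  ring

theorem sum_mul_christoffel (hg : IsSmoothMetricOn g U) (hx : x ∈ U) (m i j : ι) :
    ∑ k, g x m k * christoffel g k i j x = (1 / 2) * (pderiv i (fun y => g y j m) x +
      pderiv j (fun y => g y i m) x - pderiv m (fun y => g y i j) x) := by
  set d : ι → ℝ := fun l => pderiv i (fun y => g y j l) x + pderiv j (fun y => g y i l) x -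
    pderiv l (fun y => g y i j) x
  calc ∑ k, g x m k * christoffel g k i j x
      = ∑ k, ∑ l, (1 / 2) * (g x m k * (g x)⁻¹ k l * d l) := by
        simp only [christoffel, Finset.mul_sum, d]
        congr! 2
        ring
    _ = (1 / 2) * ∑ l, (∑ k, g x m k * (g x)⁻¹ k l) * d l := by
        rw [Finset.sum_comm]
        simp only [Finset.sum_mul, Finset.mul_sum]
    _ = (1 / 2) * d m := by simp [hg.sum_mul_inv hx]

theorem pderiv_eq_sum_christoffel (hg : IsSmoothMetricOn g U) (hx : x ∈ U) (k i j : ι) :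
    pderiv k (fun y => g y i j) x =
      ∑ l, g x j l * christoffel g l k i x + ∑ l, g x i l * christoffel g l k j x := by
  rw [hg.sum_mul_christoffel hx, hg.sum_mul_christoffel hx, hg.pderiv_symm hx k j i]
  ring

end IsSmoothMetricOn

variable [DecidableEq ι] {U : Set (𝔼 ι)} {g g' : 𝔼 ι → Matrix ι ι ℝ} {x : 𝔼 ι}

theorem christoffel_congr (hU : IsOpen U) (h : Set.EqOn g g' U) (hx : x ∈ U) (k i j : ι) :
    christoffel g k i j x = christoffel g' k i j x := by
  have hd (a b c : ι) : pderiv a (fun y => g y b c) x = pderiv a (fun y => g' y b c) x :=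
    pderiv_congr hU (fun y hy => by rw [h hy]) hx a
  simp only [christoffel, h hx, hd]

theorem ricci_congr (hU : IsOpen U) (h : Set.EqOn g g' U) (hx : x ∈ U) (i j : ι) :
    ricci g x i j = ricci g' x i j := by
  have hΓ (k a b : ι) : Set.EqOn (christoffel g k a b) (christoffel g' k a b) U :=
    fun y hy => christoffel_congr hU h hy k a b
  have hd (l k a b : ι) :
      pderiv l (christoffel g k a b) x = pderiv l (christoffel g' k a b) x :=
    pderiv_congr hU (hΓ k a b) hx l
  simp only [ricci, hΓ _ _ _ hx, hd]

end Metric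

/-! ### The geodesic spray -/

section Spray

variable {ι : Type} [Fintype ι] {n : ℕ}

/-- The full contraction `T_{a_1 … a_n} v^{a_1} ⋯ v^{a_n}` of a covariant tensor with copies of a
vector. -/
def tensorEval (T : (Fin n → ι) → ℝ) (v : 𝔼 ι) : ℝ :=
  ∑ I : Fin n → ι, T I * ∏ k, v (I k)

/-- A covariant tensor field as a fibrewise homogeneous polynomial on the tangent bundle. -/
def tensorForm (T : 𝔼 ι → (Fin n → ι) → ℝ) (p : 𝔼 ι × 𝔼 ι) : ℝ :=
  tensorEval (T p.1) p.2

/-- The quadratic form of a matrix. -/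
def quadForm (B : Matrix ι ι ℝ) (v : 𝔼 ι) : ℝ :=
  ∑ i, ∑ j, B i j * (v i * v j)

/-- The differential of a function, as a function on the tangent bundle. -/
def diffForm (f : 𝔼 ι → ℝ) (p : 𝔼 ι × 𝔼 ι) : ℝ :=
  fderiv ℝ f p.1 p.2

theorem sum_fin_succ_fun {α M : Type*} [Fintype α] [AddCommMonoid M]
    (f : (Fin (n + 1) → α) → M) : ∑ I, f I = ∑ i, ∑ I : Fin n → α, f (Fin.cons i I) := by
  rw [← (Fin.consEquiv fun _ => α).sum_comp, Fintype.sum_prod_type]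
  rfl

theorem tensorEval_rank_zero (T : (Fin 0 → ι) → ℝ) (v : 𝔼 ι) :
    tensorEval T v = T Fin.elim0 := by
  simp [tensorEval, Subsingleton.elim default (Fin.elim0 : Fin 0 → ι)]

theorem tensorEval_rank_one (a : ι → ℝ) (v : 𝔼 ι) :
    tensorEval (fun I : Fin 1 → ι => a (I 0)) v = ∑ i, v i * a i := by
  simp [tensorEval, sum_fin_succ_fun, mul_comm]

theorem tensorEval_rank_two (B : Matrix ι ι ℝ) (v : 𝔼 ι) :
    tensorEval (fun I : Fin 2 → ι => B (I 0) (I 1)) v = quadForm B v := by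
  simp [tensorEval, quadForm, sum_fin_succ_fun, Fin.prod_univ_two]

theorem contDiff_snd_apply (k : ι) : ContDiff ℝ ∞ fun p : 𝔼 ι × 𝔼 ι => p.2 k :=
  (EuclideanSpace.proj k : 𝔼 ι →L[ℝ] ℝ).contDiff.comp contDiff_snd

theorem hasFDerivAt_snd_apply (k : ι) (p : 𝔼 ι × 𝔼 ι) :
    HasFDerivAt (fun p : 𝔼 ι × 𝔼 ι => p.2 k)
      ((EuclideanSpace.proj k : 𝔼 ι →L[ℝ] ℝ).comp (ContinuousLinearMap.snd ℝ _ _)) p :=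
  (EuclideanSpace.proj k : 𝔼 ι →L[ℝ] ℝ).hasFDerivAt.comp p hasFDerivAt_snd

theorem tensorEval_succ (T : (Fin (n + 1) → ι) → ℝ) (v : 𝔼 ι) :
    tensorEval T v = ∑ i, v i * tensorEval (fun I => T (Fin.cons i I)) v := by
  simp only [tensorEval, sum_fin_succ_fun, Fin.prod_univ_succ, Fin.cons_zero, Fin.cons_succ,
    Finset.mul_sum]
  congr! 2
  ring

theorem tensorEval_contract_slot (A : Matrix ι ι ℝ) (T : (Fin n → ι) → ℝ) (v : 𝔼 ι) (k : Fin n) :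
    tensorEval (fun I => ∑ c, A c (I k) * T (Function.update I k c)) v =
      ∑ I, T I * ((∏ l ∈ Finset.univ.erase k, v (I l)) * ∑ j, A (I k) j * v j) := by
  have swap : Function.Involutive
      fun q : (Fin n → ι) × ι => (Function.update q.1 k q.2, q.1 k) := fun q => by simp
  simp only [tensorEval, Finset.sum_mul, Finset.mul_sum, ← Fintype.sum_prod_type']
  rw [← Equiv.sum_comp swap.toPerm]
  refine Finset.sum_congr rfl fun q _ => ?_
  have off_slot : ∏ l ∈ Finset.univ.erase k, v (Function.update q.1 k q.2 l) =
      ∏ l ∈ Finset.univ.erase k, v (q.1 l) :=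
    Finset.prod_congr rfl fun l hl => by rw [Function.update_of_ne (Finset.ne_of_mem_erase hl)]
  simp only [Function.Involutive.coe_toPerm, Function.update_self, Function.update_idem,
    Function.update_eq_self, ← Finset.mul_prod_erase _ _ (Finset.mem_univ k), off_slot]
  ring

variable {U : Set (𝔼 ι)}

theorem contDiffOn_comp_fst {f : 𝔼 ι → ℝ} (hf : ContDiffOn ℝ ∞ f U) :
    ContDiffOn ℝ ∞ (fun p : 𝔼 ι × 𝔼 ι => f p.1) (Prod.fst ⁻¹' U) :=
  hf.comp contDiff_fst.contDiffOn fun _ h => h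

theorem contDiffOn_tensorForm {T : 𝔼 ι → (Fin n → ι) → ℝ}
    (hT : ∀ I, ContDiffOn ℝ ∞ (fun x => T x I) U) :
    ContDiffOn ℝ ∞ (tensorForm T) (Prod.fst ⁻¹' U) :=
  ContDiffOn.sum fun I _ => (contDiffOn_comp_fst (hT I)).mul
    (contDiffOn_prod fun k _ => (contDiff_snd_apply (I k)).contDiffOn)

theorem contDiffOn_quadForm {B : 𝔼 ι → Matrix ι ι ℝ}
    (hB : ∀ i j, ContDiffOn ℝ ∞ (fun x => B x i j) U) :
    ContDiffOn ℝ ∞ (fun p : 𝔼 ι × 𝔼 ι => quadForm (B p.1) p.2) (Prod.fst ⁻¹' U) :=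
  ContDiffOn.sum fun i _ => ContDiffOn.sum fun j _ => (contDiffOn_comp_fst (hB i j)).mul
    ((contDiff_snd_apply i).mul (contDiff_snd_apply j)).contDiffOn

theorem contDiffOn_diffForm (hU : IsOpen U) {f : 𝔼 ι → ℝ} (hf : ContDiffOn ℝ ∞ f U) :
    ContDiffOn ℝ ∞ (diffForm f) (Prod.fst ⁻¹' U) :=
  ((hf.fderiv_of_isOpen hU (by simp)).comp contDiff_fst.contDiffOn fun _ h => h).clm_apply
    contDiff_snd.contDiffOn

theorem differentiableAt_tangent (hU : IsOpen U) {F : 𝔼 ι × 𝔼 ι → ℝ} {p : 𝔼 ι × 𝔼 ι}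
    (hF : ContDiffOn ℝ ∞ F (Prod.fst ⁻¹' U)) (hp : p.1 ∈ U) : DifferentiableAt ℝ F p :=
  differentiableAt_of_contDiffOn (hU.preimage continuous_fst) hF hp

variable [DecidableEq ι] {g : 𝔼 ι → Matrix ι ι ℝ} {p : 𝔼 ι × 𝔼 ι}

/-- The vertical part of the geodesic spray: geodesics satisfy `ẋ = v`, `v̇ = sprayVector g (x, v)`.
-/
def sprayVector (g : 𝔼 ι → Matrix ι ι ℝ) (p : 𝔼 ι × 𝔼 ι) : 𝔼 ι :=
  WithLp.toLp 2 fun k => -∑ i, ∑ j, christoffel g k i j p.1 * (p.2 i * p.2 j)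

/-- The derivative of a function on the tangent bundle along the geodesic spray of `g`. -/
def spray (g : 𝔼 ι → Matrix ι ι ℝ) (F : 𝔼 ι × 𝔼 ι → ℝ) (p : 𝔼 ι × 𝔼 ι) : ℝ :=
  fderiv ℝ F p (p.2, sprayVector g p)

theorem spray_congr {F G : 𝔼 ι × 𝔼 ι → ℝ} (hU : IsOpen U) (h : Set.EqOn F G (Prod.fst ⁻¹' U))
    (hp : p.1 ∈ U) : spray g F p = spray g G p := by
  rw [spray, (h.eventuallyEq_of_mem ((hU.preimage continuous_fst).mem_nhds hp)).fderiv_eq, spray]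

theorem spray_sub {F G : 𝔼 ι × 𝔼 ι → ℝ} (hF : DifferentiableAt ℝ F p)
    (hG : DifferentiableAt ℝ G p) :
    spray g (fun p => F p - G p) p = spray g F p - spray g G p := by
  simp [spray, fderiv_fun_sub hF hG]

theorem spray_mul {F G : 𝔼 ι × 𝔼 ι → ℝ} (hF : DifferentiableAt ℝ F p)
    (hG : DifferentiableAt ℝ G p) :
    spray g (fun p => F p * G p) p = spray g F p * G p + F p * spray g G p := by
  simp [spray, fderiv_fun_mul hF hG]
  ring

theorem spray_sum {α : Type*} (s : Finset α) {F : α → 𝔼 ι × 𝔼 ι → ℝ}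
    (hF : ∀ a ∈ s, DifferentiableAt ℝ (F a) p) :
    spray g (fun p => ∑ a ∈ s, F a p) p = ∑ a ∈ s, spray g (F a) p := by
  simp [spray, fderiv_fun_sum hF]

theorem spray_comp_fst {f : 𝔼 ι → ℝ} (hf : DifferentiableAt ℝ f p.1) :
    spray g (fun p => f p.1) p = diffForm f p := by
  have h : HasFDerivAt (fun p : 𝔼 ι × 𝔼 ι => f p.1)
      ((fderiv ℝ f p.1).comp (ContinuousLinearMap.fst ℝ _ _)) p :=
    hf.hasFDerivAt.comp p hasFDerivAt_fst
  rw [spray, h.fderiv, ContinuousLinearMap.comp_apply, ContinuousLinearMap.coe_fst', diffForm]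

theorem spray_prod_snd_apply (I : Fin n → ι) :
    spray g (fun p => ∏ k, p.2 (I k)) p =
      ∑ k, (∏ l ∈ Finset.univ.erase k, p.2 (I l)) * sprayVector g p (I k) := by
  have h := HasFDerivAt.finsetProd fun k (_ : k ∈ Finset.univ) => hasFDerivAt_snd_apply (I k) p
  rw [spray, h.fderiv]
  simp

theorem contDiffOn_spray (hg : IsSmoothMetricOn g U) {F : 𝔼 ι × 𝔼 ι → ℝ}
    (hF : ContDiffOn ℝ ∞ F (Prod.fst ⁻¹' U)) :
    ContDiffOn ℝ ∞ (spray g F) (Prod.fst ⁻¹' U) := by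
  refine (hF.fderiv_of_isOpen (hg.isOpen.preimage continuous_fst) (by simp)).clm_apply
    (contDiff_snd.contDiffOn.prodMk (contDiffOn_euclidean.mpr fun k => ?_))
  refine ContDiffOn.neg (ContDiffOn.sum fun i _ => ContDiffOn.sum fun j _ => ?_)
  exact (contDiffOn_comp_fst (hg.contDiffOn_christoffel k i j)).mul
    ((contDiff_snd_apply i).mul (contDiff_snd_apply j)).contDiffOn

theorem spray_tensorForm (hg : IsSmoothMetricOn g U) {T : 𝔼 ι → (Fin n → ι) → ℝ}
    (hT : ∀ I, ContDiffOn ℝ ∞ (fun x => T x I) U) (hp : p.1 ∈ U) :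
    spray g (tensorForm T) p = ∑ I, diffForm (fun y => T y I) p * ∏ k, p.2 (I k) +
      ∑ k, ∑ I, T p.1 I * ((∏ l ∈ Finset.univ.erase k, p.2 (I l)) * sprayVector g p (I k)) := by
  have hTd (I : Fin n → ι) : DifferentiableAt ℝ (fun p : 𝔼 ι × 𝔼 ι => T p.1 I) p :=
    differentiableAt_tangent hg.isOpen (contDiffOn_comp_fst (hT I)) hp
  have hprod (I : Fin n → ι) : DifferentiableAt ℝ (fun p : 𝔼 ι × 𝔼 ι => ∏ k, p.2 (I k)) p :=
    (HasFDerivAt.finsetProd fun k _ => hasFDerivAt_snd_apply (I k) p).differentiableAt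
  calc spray g (tensorForm T) p
      = ∑ I, spray g (fun p => T p.1 I * ∏ k, p.2 (I k)) p :=
        spray_sum _ fun I _ => (hTd I).fun_mul (hprod I)
    _ = ∑ I, (diffForm (fun y => T y I) p * ∏ k, p.2 (I k) + ∑ k, T p.1 I *
          ((∏ l ∈ Finset.univ.erase k, p.2 (I l)) * sprayVector g p (I k))) := by
        refine Finset.sum_congr rfl fun I _ => ?_
        rw [spray_mul (hTd I) (hprod I), spray_prod_snd_apply, Finset.mul_sum,
          spray_comp_fst (differentiableAt_of_contDiffOn hg.isOpen (hT I) hp)]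
    _ = _ := by rw [Finset.sum_add_distrib, Finset.sum_comm (s := Finset.univ (α := Fin n))]

theorem tensorEval_covDeriv (hg : IsSmoothMetricOn g U) {T : 𝔼 ι → (Fin n → ι) → ℝ}
    (hT : ∀ I, ContDiffOn ℝ ∞ (fun x => T x I) U) (hp : p.1 ∈ U) :
    tensorEval (covDeriv g T p.1) p.2 = spray g (tensorForm T) p := by
  set A : Matrix ι ι ℝ := Matrix.of fun c j => ∑ i, p.2 i * christoffel g c i j p.1 with hA
  have vertical (I : Fin n → ι) (k : Fin n) :
      sprayVector g p (I k) = -∑ j, A (I k) j * p.2 j := by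
    simp only [sprayVector, hA, Matrix.of_apply, Finset.sum_mul]
    rw [Finset.sum_comm]
    congr! 3
    ring
  have horizontal (I : Fin n → ι) : ∑ i, p.2 i * covDeriv g T p.1 (Fin.cons i I) =
      diffForm (fun y => T y I) p -
        ∑ k, ∑ c, A c (I k) * T p.1 (Function.update I k c) := by
    simp only [covDeriv, Fin.cons_zero, Fin.tail_cons (α := fun _ => ι), mul_sub,
      Finset.sum_sub_distrib, diffForm, fderiv_eq_sum_pderiv, hA, Matrix.of_apply, Finset.sum_mul,
      Finset.mul_sum]
    congr 1
    rw [Finset.sum_comm]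
    refine Finset.sum_congr rfl fun k _ => ?_
    rw [Finset.sum_comm]
    congr! 2
    ring
  rw [spray_tensorForm hg hT hp, tensorEval_succ]
  simp only [vertical, mul_neg, Finset.sum_neg_distrib, ← tensorEval_contract_slot]
  simp only [tensorEval, Finset.mul_sum]
  rw [Finset.sum_comm, Finset.sum_comm (s := Finset.univ (α := Fin n)), ← sub_eq_add_neg,
    ← Finset.sum_sub_distrib]
  refine Finset.sum_congr rfl fun I _ => ?_
  rw [← Finset.sum_mul, ← sub_mul, ← horizontal, Finset.sum_mul]
  congr! 1
  ring

theorem spray_quadForm_metric (hg : IsSmoothMetricOn g U) (hp : p.1 ∈ U) :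
    spray g (fun p => quadForm (g p.1) p.2) p = 0 := by
  set T : 𝔼 ι → (Fin 2 → ι) → ℝ := fun x I => g x (I 0) (I 1)
  have metric_compatible : covDeriv g T p.1 = 0 := by
    funext I
    simp [covDeriv, T, Fin.tail, hg.pderiv_eq_sum_christoffel hp, mul_comm, hg.symm hp _ (I 2)]
  have hform : (fun p : 𝔼 ι × 𝔼 ι => quadForm (g p.1) p.2) = tensorForm T :=
    funext fun q => (tensorEval_rank_two (g q.1) q.2).symm
  rw [hform, ← tensorEval_covDeriv hg (fun I => hg.smooth _ _) hp, metric_compatible]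
  simp [tensorEval]

end Spray

section Tensors

variable {ι : Type} {n : ℕ}

/-! ### Symmetric tensors -/

/-- Total symmetry of a covariant tensor. -/
def IsSymmTensor (T : (Fin n → ι) → ℝ) : Prop :=
  ∀ (σ : Equiv.Perm (Fin n)) (I : Fin n → ι), T (I ∘ σ) = T I

theorem cons_comp_decomposeFin (σ : Equiv.Perm (Fin n)) (a : ι) (I : Fin n → ι) :
    (Fin.cons a I : Fin (n + 1) → ι) ∘ Equiv.Perm.decomposeFin.symm (0, σ) =
      Fin.cons a (I ∘ σ) := by
  funext k
  cases k using Fin.cases with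
  | zero => simp
  | succ k => simp [Equiv.Perm.decomposeFin_symm_apply_succ]

theorem cons_cons_comp_swap (a b : ι) (I : Fin n → ι) :
    (Fin.cons b (Fin.cons a I) : Fin (n + 2) → ι) ∘ Equiv.swap 0 1 =
      Fin.cons a (Fin.cons b I) := by
  funext k
  cases k using Fin.cases with
  | zero => rfl
  | succ k =>
    cases k using Fin.cases with
    | zero => rfl
    | succ k =>
      rw [Function.comp_apply,
        Equiv.swap_apply_of_ne_of_ne (Fin.succ_ne_zero _) (Fin.succ_succ_ne_one k)]
      rfl

namespace IsSymmTensor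

theorem cons {T : (Fin (n + 1) → ι) → ℝ} (hT : IsSymmTensor T) (a : ι) :
    IsSymmTensor fun I : Fin n → ι => T (Fin.cons a I) := fun σ I =>
  (congrArg T (cons_comp_decomposeFin σ a I)).symm.trans (hT _ _)

theorem cons_cons_comm {T : (Fin (n + 2) → ι) → ℝ} (hT : IsSymmTensor T) (a b : ι)
    (I : Fin n → ι) : T (Fin.cons a (Fin.cons b I)) = T (Fin.cons b (Fin.cons a I)) := by
  rw [← cons_cons_comp_swap, hT]

theorem sub {S T : (Fin n → ι) → ℝ} (hS : IsSymmTensor S) (hT : IsSymmTensor T) :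
    IsSymmTensor (S - T) := fun σ I => by
  rw [Pi.sub_apply, Pi.sub_apply, hS, hT]

end IsSymmTensor

/-- The totally symmetric part of a tensor. -/
def symmetrize : ((Fin n → ι) → ℝ) →ₗ[ℝ] ((Fin n → ι) → ℝ) :=
  (n.factorial : ℝ)⁻¹ • ∑ σ : Equiv.Perm (Fin n), LinearMap.funLeft ℝ ℝ fun I => I ∘ σ

theorem symmetrize_eq_smul_sum (T : (Fin n → ι) → ℝ) :
    symmetrize T = (n.factorial : ℝ)⁻¹ • ∑ σ : Equiv.Perm (Fin n), fun I => T (I ∘ σ) := by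
  simp only [symmetrize, LinearMap.smul_apply, LinearMap.sum_apply]
  rfl

theorem symmetrize_apply (T : (Fin n → ι) → ℝ) (I : Fin n → ι) :
    symmetrize T I = (n.factorial : ℝ)⁻¹ * ∑ σ : Equiv.Perm (Fin n), T (I ∘ σ) := by
  simp [symmetrize_eq_smul_sum]

theorem factorial_inv_mul_sum_const (c : ℝ) :
    (n.factorial : ℝ)⁻¹ * ∑ _σ : Equiv.Perm (Fin n), c = c := by
  simp [Fintype.card_perm, Nat.factorial_ne_zero]

theorem isSymmTensor_symmetrize (T : (Fin n → ι) → ℝ) : IsSymmTensor (symmetrize T) := by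
  intro σ I
  rw [symmetrize_apply, symmetrize_apply]
  congr 1
  exact Equiv.sum_comp (Equiv.mulLeft σ) fun τ : Equiv.Perm (Fin n) => T (I ∘ τ)

theorem IsSymmTensor.symmetrize_eq {T : (Fin n → ι) → ℝ} (hT : IsSymmTensor T) :
    symmetrize T = T := by
  funext I
  simp only [symmetrize_apply, hT _ I, factorial_inv_mul_sum_const]

/-- The product `B ⊗ Z` of a bilinear form with a tensor. -/
def bilinProd (B : Matrix ι ι ℝ) : ((Fin n → ι) → ℝ) →ₗ[ℝ] ((Fin (n + 2) → ι) → ℝ) where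
  toFun Z I := B (I 0) (I 1) * Z (Fin.tail (Fin.tail I))
  map_add' Z Z' := by funext I; simp [mul_add]
  map_smul' c Z := by funext I; simp [mul_left_comm]

theorem bilinProd_cons_cons (B : Matrix ι ι ℝ) (Z : (Fin n → ι) → ℝ) (a b : ι) (I : Fin n → ι) :
    bilinProd B Z (Fin.cons a (Fin.cons b I)) = B a b * Z I := rfl

section Smooth

variable {E : Type*} [NormedAddCommGroup E] [NormedSpace ℝ E] {s : Set E}

theorem contDiffOn_symmetrize {T : E → (Fin n → ι) → ℝ}
    (hT : ∀ I, ContDiffOn ℝ ∞ (fun x => T x I) s) (I : Fin n → ι) :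
    ContDiffOn ℝ ∞ (fun x => symmetrize (T x) I) s := by
  simp only [symmetrize_apply]
  exact contDiffOn_const.mul (ContDiffOn.sum fun σ _ => hT _)

theorem contDiffOn_bilinProd {B : E → Matrix ι ι ℝ}
    (hB : ∀ i j, ContDiffOn ℝ ∞ (fun x => B x i j) s)
    {T : E → (Fin n → ι) → ℝ} (hT : ∀ I, ContDiffOn ℝ ∞ (fun x => T x I) s)
    (I : Fin (n + 2) → ι) : ContDiffOn ℝ ∞ (fun x => bilinProd (B x) (T x) I) s :=
  (hB _ _).mul (hT _)

end Smooth

variable [Fintype ι]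

/-! ### Full contractions with a vector -/

theorem contDiff_tensorEval (T : (Fin n → ι) → ℝ) : ContDiff ℝ ∞ (tensorEval T) :=
  ContDiff.sum fun I _ => contDiff_const.mul
    (contDiff_prod fun k _ => (EuclideanSpace.proj (I k) : 𝔼 ι →L[ℝ] ℝ).contDiff)

theorem tensorEval_sub (S T : (Fin n → ι) → ℝ) (v : 𝔼 ι) :
    tensorEval (S - T) v = tensorEval S v - tensorEval T v := by
  simp [tensorEval, sub_mul]

theorem tensorEval_smul (c : ℝ) (T : (Fin n → ι) → ℝ) (v : 𝔼 ι) :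
    tensorEval (c • T) v = c * tensorEval T v := by
  simp [tensorEval, Finset.mul_sum, mul_assoc]

theorem tensorEval_smul_vector (T : (Fin n → ι) → ℝ) (t : ℝ) (v : 𝔼 ι) :
    tensorEval T (t • v) = t ^ n * tensorEval T v := by
  simp only [tensorEval, PiLp.smul_apply, smul_eq_mul, Finset.prod_mul_distrib, Finset.prod_const,
    Finset.card_univ, Fintype.card_fin, Finset.mul_sum]
  exact Finset.sum_congr rfl fun I _ => by ring

theorem quadForm_smul_vector (B : Matrix ι ι ℝ) (t : ℝ) (v : 𝔼 ι) :
    quadForm B (t • v) = t ^ 2 * quadForm B v := by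
  simp only [quadForm, PiLp.smul_apply, smul_eq_mul, Finset.mul_sum]
  exact Finset.sum_congr rfl fun i _ => Finset.sum_congr rfl fun j _ => by ring

theorem quadForm_pos {H : Matrix ι ι ℝ} (hH : H.PosDef) {v : 𝔼 ι} (hv : v ≠ 0) :
    0 < quadForm H v := by
  have hv' : v.ofLp ≠ 0 := fun h => hv (by ext i; exact congrFun h i)
  refine (hH.dotProduct_mulVec_pos hv').trans_eq ?_
  simp only [quadForm, dotProduct, Matrix.mulVec, Finset.mul_sum, star_trivial]
  exact Finset.sum_congr rfl fun i _ => Finset.sum_congr rfl fun j _ => by ring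

theorem tensorEval_bilinProd (B : Matrix ι ι ℝ) (Z : (Fin n → ι) → ℝ) (v : 𝔼 ι) :
    tensorEval (bilinProd B Z) v = quadForm B v * tensorEval Z v := by
  simp only [tensorEval_succ, bilinProd_cons_cons, quadForm, Finset.sum_mul, Finset.mul_sum]
  refine Finset.sum_congr rfl fun i _ => Finset.sum_congr rfl fun j _ => ?_
  simp only [tensorEval, Finset.mul_sum]
  exact Finset.sum_congr rfl fun I _ => by ring

theorem sum_comp_perm (σ : Equiv.Perm (Fin n)) (f : (Fin n → ι) → ℝ) :
    ∑ I, f (I ∘ σ) = ∑ I, f I :=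
  (Equiv.arrowCongr σ.symm (Equiv.refl ι)).sum_comp f

theorem tensorEval_comp_perm (T : (Fin n → ι) → ℝ) (σ : Equiv.Perm (Fin n)) (v : 𝔼 ι) :
    tensorEval (fun I => T (I ∘ σ)) v = tensorEval T v := by
  rw [tensorEval, tensorEval, ← sum_comp_perm σ fun I => T I * ∏ k, v (I k)]
  refine Finset.sum_congr rfl fun I _ => ?_
  rw [← Equiv.prod_comp σ fun k => v (I k)]
  rfl

theorem tensorEval_symmetrize (T : (Fin n → ι) → ℝ) (v : 𝔼 ι) :
    tensorEval (symmetrize T) v = tensorEval T v := by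
  have hsum : tensorEval (∑ σ : Equiv.Perm (Fin n), fun I => T (I ∘ σ)) v =
      ∑ σ : Equiv.Perm (Fin n), tensorEval (fun I => T (I ∘ σ)) v := by
    simp only [tensorEval, Finset.sum_apply, Finset.sum_mul]
    exact Finset.sum_comm
  rw [symmetrize_eq_smul_sum, tensorEval_smul, hsum]
  simp only [tensorEval_comp_perm, factorial_inv_mul_sum_const]

theorem fderiv_tensorEval_succ (T : (Fin (n + 1) → ι) → ℝ) (v w : 𝔼 ι) :
    fderiv ℝ (tensorEval T) v w =
      ∑ i, w i * tensorEval (fun I : Fin n → ι => T (Fin.cons i I)) v +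
        ∑ i, v i * fderiv ℝ (tensorEval fun I : Fin n → ι => T (Fin.cons i I)) v w := by
  have heval : ∀ i, HasFDerivAt (tensorEval fun I : Fin n → ι => T (Fin.cons i I)) _ v := fun i =>
    ((contDiff_tensorEval _).differentiable (by simp) v).hasFDerivAt
  have hcoord : ∀ i, HasFDerivAt (fun v : 𝔼 ι => v i) (EuclideanSpace.proj i : 𝔼 ι →L[ℝ] ℝ) v :=
    fun i => (EuclideanSpace.proj i : 𝔼 ι →L[ℝ] ℝ).hasFDerivAt
  have hsum := HasFDerivAt.fun_sum (u := Finset.univ) fun i _ => (hcoord i).fun_mul (heval i)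
  rw [show tensorEval T = _ from funext fun v => tensorEval_succ T v, hsum.fderiv,
    ← Finset.sum_add_distrib]
  simp only [sum_apply, add_apply, smul_apply, smul_eq_mul, PiLp.proj_apply]
  exact Finset.sum_congr rfl fun i _ => by ring

theorem IsSymmTensor.fderiv_tensorEval {T : (Fin (n + 1) → ι) → ℝ} (hT : IsSymmTensor T)
    (v w : 𝔼 ι) : fderiv ℝ (tensorEval T) v w =
      (n + 1) * ∑ i, w i * tensorEval (fun I : Fin n → ι => T (Fin.cons i I)) v := by
  induction n with
  | zero =>
    have hconst : ∀ i, (tensorEval fun I : Fin 0 → ι => T (Fin.cons i I)) =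
        fun _ => T (Fin.cons i Fin.elim0) := fun i => funext fun v => tensorEval_rank_zero _ v
    simp [fderiv_tensorEval_succ, hconst]
  | succ n ih =>
    have hslots : ∑ i, v i *
        fderiv ℝ (tensorEval fun I : Fin (n + 1) → ι => T (Fin.cons i I)) v w =
        (n + 1) * ∑ j, w j * tensorEval (fun I : Fin (n + 1) → ι => T (Fin.cons j I)) v := by
      simp only [fun i => ih (hT.cons i), tensorEval_succ (n := n), Finset.mul_sum]
      rw [Finset.sum_comm]
      refine Finset.sum_congr rfl fun j _ => Finset.sum_congr rfl fun i _ => ?_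
      simp only [hT.cons_cons_comm i j]
      ring
    rw [fderiv_tensorEval_succ, hslots]
    push_cast
    ring

theorem IsSymmTensor.eq_zero_of_tensorEval {T : (Fin n → ι) → ℝ} (hT : IsSymmTensor T)
    (h : ∀ v, tensorEval T v = 0) : T = 0 := by
  classical
  induction n with
  | zero =>
    funext I
    rw [Subsingleton.elim I Fin.elim0, ← tensorEval_rank_zero T 0, h, Pi.zero_apply]
  | succ n ih =>
    have hslot : ∀ a, (fun I : Fin n → ι => T (Fin.cons a I)) = 0 := fun a => by
      refine ih (hT.cons a) fun v => ?_
      have hderiv := hT.fderiv_tensorEval v (EuclideanSpace.single a 1)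
      rw [show tensorEval T = fun _ => 0 from funext h] at hderiv
      simp only [fderiv_fun_const, Pi.zero_apply, zero_apply, PiLp.single_apply, ite_mul,
        one_mul, zero_mul, Finset.sum_ite_eq', Finset.mem_univ, if_true, zero_eq_mul] at hderiv
      exact hderiv.resolve_left (by positivity)
    funext I
    rw [← Fin.cons_self_tail I]
    exact congrFun (hslot (I 0)) (Fin.tail I)

theorem IsSymmTensor.eq_of_tensorEval {S T : (Fin n → ι) → ℝ} (hS : IsSymmTensor S)
    (hT : IsSymmTensor T) (h : ∀ v, tensorEval S v = tensorEval T v) : S = T :=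
  sub_eq_zero.mp <| (hS.sub hT).eq_zero_of_tensorEval fun v => by
    rw [tensorEval_sub, h, sub_self]

theorem IsSymmTensor.eq_zero_of_symmetrize_metricProd [Nonempty ι] {H : Matrix ι ι ℝ}
    (hH : H.PosDef) {Z : (Fin n → ι) → ℝ} (hZ : IsSymmTensor Z)
    (h : symmetrize (bilinProd H Z) = 0) : Z = 0 := by
  have hoff : ∀ v ≠ 0, tensorEval Z v = 0 := fun v hv => by
    have hprod : quadForm H v * tensorEval Z v = 0 := by
      rw [← tensorEval_bilinProd, ← tensorEval_symmetrize, h]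
      simp [tensorEval]
    exact (mul_eq_zero.mp hprod).resolve_left (quadForm_pos hH hv).ne'
  have heval : tensorEval Z = fun _ => 0 :=
    Continuous.ext_on (dense_compl_singleton (0 : 𝔼 ι)) (contDiff_tensorEval Z).continuous
      continuous_const hoff
  exact hZ.eq_zero_of_tensorEval (congrFun heval)

theorem pow_mul_tensorEval_eq {H : Matrix ι ι ℝ} {S : (Fin n → ι) → ℝ} {Z : 𝔼 ι → ℝ}
    (h : ∀ v, tensorEval S v = quadForm H v * Z v) (t : ℝ) (v : 𝔼 ι) :
    t ^ n * tensorEval S v = t ^ 2 * quadForm H v * Z (t • v) := by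
  rw [← tensorEval_smul_vector, h, quadForm_smul_vector]

theorem tensorEval_eq_zero_of_eq_quadForm_mul {H : Matrix ι ι ℝ} (hn : n < 2)
    {S : (Fin n → ι) → ℝ} {Z : 𝔼 ι → ℝ} (hZ : Continuous Z)
    (h : ∀ v, tensorEval S v = quadForm H v * Z v) (v : 𝔼 ι) : tensorEval S v = 0 := by
  have hray : (fun _ : ℝ => tensorEval S v) =
      fun t => t ^ (2 - n) * (quadForm H v * Z (t • v)) := by
    refine Continuous.ext_on (dense_compl_singleton (0 : ℝ)) continuous_const (by fun_prop)
      fun t ht => mul_left_cancel₀ (pow_ne_zero n ht) ?_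
    rw [pow_mul_tensorEval_eq h, ← mul_assoc, ← pow_add, Nat.add_sub_cancel' hn.le, mul_assoc]
  simpa [Nat.sub_eq_zero_iff_le, hn] using congrFun hray 0

theorem smul_vector_eq_of_eq_quadForm_mul {H : Matrix ι ι ℝ} (hH : H.PosDef)
    {S : (Fin (n + 2) → ι) → ℝ} {Z : 𝔼 ι → ℝ} (hZ : Continuous Z)
    (h : ∀ v, tensorEval S v = quadForm H v * Z v) {v : 𝔼 ι} (hv : v ≠ 0) (t : ℝ) :
    Z (t • v) = t ^ n * Z v := by
  have hray : (fun t : ℝ => Z (t • v)) = fun t => t ^ n * Z v := by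
    refine Continuous.ext_on (dense_compl_singleton (0 : ℝ)) (by fun_prop) (by fun_prop)
      fun t ht => mul_left_cancel₀ (mul_ne_zero (pow_ne_zero 2 ht) (quadForm_pos hH hv).ne') ?_
    rw [← pow_mul_tensorEval_eq h, h]
    ring
  exact congrFun hray t

variable [DecidableEq ι] {H : Matrix ι ι ℝ}

/-! ### The inner product of tensors -/

theorem tensorInner_sub_left (S T X : (Fin n → ι) → ℝ) :
    tensorInner H (S - T) X = tensorInner H S X - tensorInner H T X := by
  simp [tensorInner, mul_sub, sub_mul, Finset.sum_sub_distrib]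

theorem tensorInner_smul_left (c : ℝ) (S X : (Fin n → ι) → ℝ) :
    tensorInner H (c • S) X = c * tensorInner H S X := by
  simp only [tensorInner, Finset.mul_sum, Pi.smul_apply, smul_eq_mul]
  exact Finset.sum_congr rfl fun I _ => Finset.sum_congr rfl fun J _ => by ring

theorem tensorInner_smul_right (c : ℝ) (S X : (Fin n → ι) → ℝ) :
    tensorInner H S (c • X) = c * tensorInner H S X := by
  simp only [tensorInner, Finset.mul_sum, Pi.smul_apply, smul_eq_mul]
  exact Finset.sum_congr rfl fun I _ => Finset.sum_congr rfl fun J _ => by ring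

theorem tensorInner_sum_left {α : Type*} (s : Finset α) (S : α → (Fin n → ι) → ℝ)
    (X : (Fin n → ι) → ℝ) :
    tensorInner H (∑ a ∈ s, S a) X = ∑ a ∈ s, tensorInner H (S a) X := by
  simp only [tensorInner, Finset.sum_apply, Finset.mul_sum, Finset.sum_mul]
  exact Finset.sum_comm_cycle

theorem tensorInner_sum_right {α : Type*} (s : Finset α) (S : (Fin n → ι) → ℝ)
    (X : α → (Fin n → ι) → ℝ) :
    tensorInner H S (∑ a ∈ s, X a) = ∑ a ∈ s, tensorInner H S (X a) := by
  simp only [tensorInner, Finset.sum_apply, Finset.mul_sum]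
  exact Finset.sum_comm_cycle

theorem tensorInner_zero_right (S : (Fin n → ι) → ℝ) : tensorInner H S 0 = 0 := by
  simp [tensorInner]

theorem tensorInner_succ (S X : (Fin (n + 1) → ι) → ℝ) :
    tensorInner H S X = ∑ a, ∑ c, H⁻¹ a c * tensorInner H (fun I : Fin n → ι => S (Fin.cons a I))
      (fun I : Fin n → ι => X (Fin.cons c I)) := by
  simp only [tensorInner, sum_fin_succ_fun, Fin.prod_univ_succ, Fin.cons_zero, Fin.cons_succ,
    Finset.mul_sum]
  refine Finset.sum_congr rfl fun a _ => ?_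
  rw [Finset.sum_comm]
  exact Finset.sum_congr rfl fun c _ => Finset.sum_congr rfl fun I _ =>
    Finset.sum_congr rfl fun J _ => by ring

theorem IsSymmTensor.tensorInner_comp_perm {X : (Fin n → ι) → ℝ} (hX : IsSymmTensor X)
    (T : (Fin n → ι) → ℝ) (σ : Equiv.Perm (Fin n)) :
    tensorInner H (fun I => T (I ∘ σ)) X = tensorInner H T X := by
  refine Eq.trans (Finset.sum_congr rfl fun I _ => ?_) (sum_comp_perm σ _)
  refine Eq.trans (Finset.sum_congr rfl fun J _ => ?_) (sum_comp_perm σ _)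
  rw [hX, ← Equiv.prod_comp σ fun k => H⁻¹ (I k) (J k)]
  rfl

theorem IsSymmTensor.tensorInner_symmetrize {X : (Fin n → ι) → ℝ} (hX : IsSymmTensor X)
    (T : (Fin n → ι) → ℝ) : tensorInner H (symmetrize T) X = tensorInner H T X := by
  rw [symmetrize_eq_smul_sum, tensorInner_smul_left, tensorInner_sum_left]
  simp only [hX.tensorInner_comp_perm, factorial_inv_mul_sum_const]

/-! ### Traces -/

/-- The contraction of the first two indices of a tensor with the inverse of the metric `H`. -/
def metricTrace (H : Matrix ι ι ℝ) : ((Fin (n + 2) → ι) → ℝ) →ₗ[ℝ] ((Fin n → ι) → ℝ) where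
  toFun Y I := ∑ a, ∑ b, H⁻¹ a b * Y (Fin.cons a (Fin.cons b I))
  map_add' Z Z' := by funext I; simp [mul_add, Finset.sum_add_distrib]
  map_smul' c Z := by funext I; simp [mul_left_comm, Finset.mul_sum]

theorem metricTrace_apply (Y : (Fin (n + 2) → ι) → ℝ) (I : Fin n → ι) :
    metricTrace H Y I = ∑ a, ∑ b, H⁻¹ a b * Y (Fin.cons a (Fin.cons b I)) := rfl

theorem IsSymmTensor.metricTrace {Y : (Fin (n + 2) → ι) → ℝ} (hY : IsSymmTensor Y) :
    IsSymmTensor (metricTrace H Y) := fun σ I =>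
  Finset.sum_congr rfl fun a _ => Finset.sum_congr rfl fun b _ =>
    congrArg _ (((hY.cons a).cons b) σ I)

theorem tensorInner_bilinProd (B : Matrix ι ι ℝ) (Z : (Fin n → ι) → ℝ)
    (X : (Fin (n + 2) → ι) → ℝ) :
    tensorInner H (bilinProd B Z) X = ∑ c, ∑ d, (H⁻¹.transpose * B * H⁻¹) c d *
      tensorInner H Z fun I => X (Fin.cons c (Fin.cons d I)) := by
  have hslots : ∀ a b, (fun I : Fin n → ι => bilinProd B Z (Fin.cons a (Fin.cons b I))) =
      B a b • Z := fun a b => rfl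
  simp only [tensorInner_succ, hslots, tensorInner_smul_left, Matrix.mul_apply,
    Matrix.transpose_apply, Finset.mul_sum, Finset.sum_mul]
  rw [Finset.sum_comm]
  refine Finset.sum_congr rfl fun c _ => ?_
  rw [Finset.sum_comm_cycle]
  refine Finset.sum_congr rfl fun d _ => ?_
  rw [Finset.sum_comm]
  exact Finset.sum_congr rfl fun b _ => Finset.sum_congr rfl fun a _ => by ring

theorem tensorInner_metricProd (hH : H.PosDef) (Z : (Fin n → ι) → ℝ)
    (X : (Fin (n + 2) → ι) → ℝ) :
    tensorInner H (bilinProd H Z) X = tensorInner H Z (metricTrace H X) := by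
  have hraise : H⁻¹.transpose * H * H⁻¹ = H⁻¹ := by
    rw [Matrix.mul_assoc, Matrix.mul_nonsing_inv _ hH.det_pos.ne'.isUnit, Matrix.mul_one,
      ← Matrix.conjTranspose_eq_transpose_of_trivial]
    exact hH.inv.isHermitian
  have htrace : metricTrace H X =
      ∑ c, ∑ d, H⁻¹ c d • fun I : Fin n → ι => X (Fin.cons c (Fin.cons d I)) := by
    funext I
    simp [metricTrace_apply]
  simp only [tensorInner_bilinProd, hraise, htrace, tensorInner_sum_right, tensorInner_smul_right]

end Tensors

section TraceFree

variable {ι : Type} [Fintype ι] [DecidableEq ι] {n : ℕ} {H : Matrix ι ι ℝ}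

/-! ### The symmetric trace-free part -/

theorem isSTF_rank_zero (T : (Fin 0 → ι) → ℝ) : IsSTF H T :=
  ⟨fun _ _ => congrArg T (Subsingleton.elim _ _), fun k => k.elim0⟩

theorem isSTF_rank_one (T : (Fin 1 → ι) → ℝ) : IsSTF H T :=
  ⟨fun _ I => congrArg T (funext fun _ => congrArg I (Subsingleton.elim _ _)),
    fun _ _ hkl => (hkl (Subsingleton.elim _ _)).elim⟩

theorem IsSTF.metricTrace_eq_zero {X : (Fin (n + 2) → ι) → ℝ} (hX : IsSTF H X) :
    metricTrace H X = 0 := by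
  funext I
  rw [metricTrace_apply]
  rcases isEmpty_or_nonempty ι with _ | ⟨⟨c⟩⟩
  · simp
  · refine Eq.trans ?_ (hX.traceFree 0 1 (by simp) (Fin.cons c (Fin.cons c I)))
    refine Finset.sum_congr rfl fun a _ => Finset.sum_congr rfl fun b _ => ?_
    congr 2
    rw [Fin.update_cons_zero, ← Fin.succ_zero_eq_one, ← Fin.cons_update, Fin.update_cons_zero]

theorem exists_perm_zero_one {k l : Fin (n + 2)} (hkl : k ≠ l) :
    ∃ σ : Equiv.Perm (Fin (n + 2)), σ 0 = k ∧ σ 1 = l := by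
  have hswap : Equiv.swap 0 k 1 ≠ k := fun h =>
    one_ne_zero ((Equiv.swap 0 k).injective (h.trans (Equiv.swap_apply_left 0 k).symm))
  refine ⟨Equiv.swap (Equiv.swap 0 k 1) l * Equiv.swap 0 k, ?_, ?_⟩
  · rw [Equiv.Perm.mul_apply, Equiv.swap_apply_left,
      Equiv.swap_apply_of_ne_of_ne hswap.symm hkl]
  · rw [Equiv.Perm.mul_apply, Equiv.swap_apply_left]

theorem isSTF_of_metricTrace_eq_zero {X : (Fin (n + 2) → ι) → ℝ} (hX : IsSymmTensor X)
    (h : metricTrace H X = 0) : IsSTF H X := by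
  refine ⟨hX, fun k l hkl I => ?_⟩
  obtain ⟨σ, rfl, rfl⟩ := exists_perm_zero_one hkl
  have hfront : ∀ a b, X (Function.update (Function.update I (σ 0) a) (σ 1) b) =
      X (Fin.cons a (Fin.cons b (Fin.tail (Fin.tail (I ∘ σ))))) := fun a b => by
    rw [← hX σ]
    congr 1
    funext m
    cases m using Fin.cases with
    | zero => simp
    | succ m =>
      cases m using Fin.cases with
      | zero => simp
      | succ m => simp [Fin.tail, Fin.succ_succ_ne_one]
  simp only [hfront]
  exact congrFun h _

theorem IsSTF.tensorInner_symmetrize_metricProd (hH : H.PosDef) {X : (Fin (n + 2) → ι) → ℝ}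
    (hX : IsSTF H X) (Z : (Fin n → ι) → ℝ) :
    tensorInner H (symmetrize (bilinProd H Z)) X = 0 := by
  rw [IsSymmTensor.tensorInner_symmetrize hX.symm, tensorInner_metricProd hH,
    hX.metricTrace_eq_zero, tensorInner_zero_right]

theorem stfPart_eq (hH : H.PosDef) {T S : (Fin n → ι) → ℝ} (h : IsSTFPart H T S) :
    stfPart H T = S := by
  have hex : ∃ S, IsSTFPart H T S := ⟨S, h⟩
  rw [stfPart, dif_pos hex]
  exact (existsUnique_isSTFPart hH T).unique hex.choose_spec h

theorem isSTF_stfPart (hH : H.PosDef) (T : (Fin n → ι) → ℝ) : IsSTF H (stfPart H T) := by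
  obtain ⟨S, hS, -⟩ := existsUnique_isSTFPart hH T
  rw [stfPart_eq hH hS]
  exact hS.1

theorem IsSTF.stfPart_eq_self (hH : H.PosDef) {T : (Fin n → ι) → ℝ} (h : IsSTF H T) :
    stfPart H T = T :=
  stfPart_eq hH ⟨h, fun X _ => by simp [tensorInner]⟩

/-- The endomorphism equal to `Z ↦ tr Sym (H ⊗ Z)` on symmetric tensors and to the identity on
tensors without symmetric part. Inverting it yields the trace terms to be subtracted from a
symmetric tensor to make it trace-free. -/
def traceOperator (H : Matrix ι ι ℝ) : ((Fin n → ι) → ℝ) →ₗ[ℝ] ((Fin n → ι) → ℝ) :=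
  metricTrace H ∘ₗ symmetrize ∘ₗ bilinProd H ∘ₗ symmetrize + (LinearMap.id - symmetrize)

theorem traceOperator_apply (Z : (Fin n → ι) → ℝ) : traceOperator H Z =
    metricTrace H (symmetrize (bilinProd H (symmetrize Z))) + (Z - symmetrize Z) := rfl

theorem IsSymmTensor.traceOperator_eq {Z : (Fin n → ι) → ℝ} (hZ : IsSymmTensor Z) :
    traceOperator H Z = Multipole.metricTrace H (symmetrize (bilinProd H Z)) := by
  rw [traceOperator_apply, hZ.symmetrize_eq, sub_self, add_zero]

theorem isSymmTensor_of_traceOperator {Z : (Fin n → ι) → ℝ}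
    (h : IsSymmTensor (traceOperator H Z)) : IsSymmTensor Z := by
  have hfix : symmetrize Z = Z := by
    have hsymm := h.symmetrize_eq
    rw [traceOperator_apply, map_add, map_sub,
      (isSymmTensor_symmetrize _).metricTrace.symmetrize_eq,
      (isSymmTensor_symmetrize Z).symmetrize_eq, sub_self, add_zero, left_eq_add,
      sub_eq_zero] at hsymm
    exact hsymm.symm
  rw [← hfix]
  exact isSymmTensor_symmetrize Z

theorem traceOperator_injective [Nonempty ι] (hH : H.PosDef) :
    Function.Injective (traceOperator H : ((Fin n → ι) → ℝ) →ₗ[ℝ] _) := by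
  refine (injective_iff_map_eq_zero _).mpr fun Z hZ => ?_
  have hsymm : IsSymmTensor Z := isSymmTensor_of_traceOperator (H := H) <| by
    rw [hZ]
    exact fun _ _ => rfl
  rw [hsymm.traceOperator_eq] at hZ
  refine hsymm.eq_zero_of_symmetrize_metricProd hH ?_
  refine eq_zero_of_tensorInner_self_nonpos hH (le_of_eq ?_)
  rw [(isSymmTensor_symmetrize _).tensorInner_symmetrize, tensorInner_metricProd hH, hZ,
    tensorInner_zero_right]

theorem stfPart_eq_symmetrize (hH : H.PosDef) {T : (Fin (n + 2) → ι) → ℝ} {Z : (Fin n → ι) → ℝ}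
    (hZ : traceOperator H Z = metricTrace H (symmetrize T)) :
    stfPart H T = symmetrize (T - bilinProd H Z) := by
  have hsymm : IsSymmTensor Z := isSymmTensor_of_traceOperator (H := H) <| by
    rw [hZ]
    exact (isSymmTensor_symmetrize T).metricTrace
  rw [hsymm.traceOperator_eq] at hZ
  refine stfPart_eq hH ⟨isSTF_of_metricTrace_eq_zero (isSymmTensor_symmetrize _) ?_,
    fun X hX => ?_⟩
  · rw [map_sub, map_sub, hZ, sub_self]
  · rw [tensorInner_sub_left, map_sub, tensorInner_sub_left,
      hX.tensorInner_symmetrize_metricProd hH, IsSymmTensor.tensorInner_symmetrize hX.symm]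
    ring

/-! ### Trace-free tensors whose polynomial is a multiple of the metric -/

theorem tensorEval_iteratedFDeriv (Z : 𝔼 ι → ℝ) (v : 𝔼 ι) :
    tensorEval (fun I : Fin n → ι => iteratedFDeriv ℝ n Z 0 fun k =>
      EuclideanSpace.single (I k) 1) v = iteratedFDeriv ℝ n Z 0 fun _ => v := by
  conv_rhs => rw [← sum_smul_single v]
  rw [ContinuousMultilinearMap.map_sum]
  simp only [ContinuousMultilinearMap.map_smul_univ, tensorEval, smul_eq_mul]
  exact Finset.sum_congr rfl fun I _ => by ring

theorem iteratedFDeriv_zero_apply_of_homogeneous {E : Type*} [NormedAddCommGroup E]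
    [NormedSpace ℝ E] {Z : E → ℝ} (hZ : ContDiff ℝ n Z) {v : E}
    (h : ∀ t : ℝ, Z (t • v) = t ^ n * Z v) :
    (iteratedFDeriv ℝ n Z 0 fun _ => v) = n.factorial * Z v := by
  have hline : Z ∘ ContinuousLinearMap.toSpanSingleton ℝ v = fun t : ℝ => Z v * t ^ n :=
    funext fun t => (h t).trans (mul_comm _ _)
  have hcomp := ContinuousLinearMap.iteratedFDeriv_comp_right
    (ContinuousLinearMap.toSpanSingleton ℝ v) hZ 0 le_rfl
  have hderiv : iteratedDeriv n (fun t : ℝ => Z v * t ^ n) 0 =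
      iteratedFDeriv ℝ n Z 0 fun _ => v := by
    rw [iteratedDeriv_eq_iteratedFDeriv, ← hline, hcomp]
    simp
  rw [← hderiv, iteratedDeriv_const_mul_field, iteratedDeriv_pow]
  simp [Nat.descFactorial_self, mul_comm]

omit [DecidableEq ι] in
theorem exists_tensorEval_eq_of_homogeneous {Z : 𝔼 ι → ℝ} (hZ : ContDiff ℝ n Z)
    (h : ∀ v ≠ 0, ∀ t : ℝ, Z (t • v) = t ^ n * Z v) :
    ∃ T : (Fin n → ι) → ℝ, ∀ v ≠ 0, tensorEval T v = Z v := by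
  classical
  refine ⟨(n.factorial : ℝ)⁻¹ • fun I => iteratedFDeriv ℝ n Z 0 fun k =>
    EuclideanSpace.single (I k) 1, fun v hv => ?_⟩
  rw [tensorEval_smul, tensorEval_iteratedFDeriv,
    iteratedFDeriv_zero_apply_of_homogeneous hZ (h v hv), inv_mul_cancel_left₀ (by positivity)]

theorem IsSTF.eq_zero_of_tensorEval_eq (hH : H.PosDef) {S : (Fin n → ι) → ℝ} (hS : IsSTF H S)
    {Z : 𝔼 ι → ℝ} (hZ : ContDiff ℝ ∞ Z) (h : ∀ v, tensorEval S v = quadForm H v * Z v) :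
    S = 0 := by
  rcases lt_or_ge n 2 with hn | hn
  · exact IsSymmTensor.eq_zero_of_tensorEval hS.symm
      (tensorEval_eq_zero_of_eq_quadForm_mul hn hZ.continuous h)
  obtain ⟨m, rfl⟩ := Nat.exists_eq_add_of_le' hn
  obtain ⟨T, hT⟩ := exists_tensorEval_eq_of_homogeneous
    (hZ.of_le (by exact_mod_cast le_top)) fun v hv t =>
      smul_vector_eq_of_eq_quadForm_mul hH hZ.continuous h hv t
  have hmultiple : S = symmetrize (bilinProd H T) := by
    refine IsSymmTensor.eq_of_tensorEval hS.symm (isSymmTensor_symmetrize _) fun v => ?_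
    rw [tensorEval_symmetrize, tensorEval_bilinProd, h]
    rcases eq_or_ne v 0 with rfl | hv
    · simp [quadForm]
    · rw [hT v hv]
  refine eq_zero_of_tensorInner_self_nonpos hH (le_of_eq ?_)
  conv_lhs => enter [2]; rw [hmultiple]
  exact hS.tensorInner_symmetrize_metricProd hH T

/-! ### Smooth dependence of the trace-free part on the metric -/

theorem exists_contDiffOn_linearMap_apply_eq {κ E : Type*} [Finite κ]
    [NormedAddCommGroup E] [NormedSpace ℝ E] {s : Set E} {L : E → (κ → ℝ) →ₗ[ℝ] (κ → ℝ)}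
    (hL : ∀ Y I, ContDiffOn ℝ ∞ (fun x => L x Y I) s) (hinj : ∀ x ∈ s, Function.Injective (L x))
    {Y : E → κ → ℝ} (hY : ∀ I, ContDiffOn ℝ ∞ (fun x => Y x I) s) :
    ∃ Z : E → κ → ℝ, (∀ I, ContDiffOn ℝ ∞ (fun x => Z x I) s) ∧ ∀ x ∈ s, L x (Z x) = Y x := by
  classical
  cases nonempty_fintype κ
  have hdet : ∀ x ∈ s, IsUnit (LinearMap.toMatrix' (L x)).det := fun x hx => by
    rw [← Matrix.isUnit_iff_isUnit_det, ← Matrix.mulVec_injective_iff_isUnit]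
    intro v w hvw
    simp only [LinearMap.toMatrix'_mulVec] at hvw
    exact hinj x hx hvw
  refine ⟨fun x => (LinearMap.toMatrix' (L x))⁻¹.mulVec (Y x), fun I => ?_, fun x hx => ?_⟩
  · exact ContDiffOn.sum fun J _ => (contDiffOn_matrix_inv (fun I J => hL _ I)
      (fun x hx => (hdet x hx).ne_zero) I J).mul (hY J)
  · rw [← LinearMap.toMatrix'_mulVec, Matrix.mulVec_mulVec, Matrix.mul_nonsing_inv _ (hdet x hx),
      Matrix.one_mulVec]

variable {U : Set (𝔼 ι)} {g : 𝔼 ι → Matrix ι ι ℝ}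

theorem contDiffOn_metricTrace (hg : IsSmoothMetricOn g U) {T : 𝔼 ι → (Fin (n + 2) → ι) → ℝ}
    (hT : ∀ I, ContDiffOn ℝ ∞ (fun x => T x I) U) (I : Fin n → ι) :
    ContDiffOn ℝ ∞ (fun x => metricTrace (g x) (T x) I) U :=
  ContDiffOn.sum fun a _ => ContDiffOn.sum fun b _ => (hg.contDiffOn_inv a b).mul (hT _)

theorem contDiffOn_traceOperator (hg : IsSmoothMetricOn g U) (Y : (Fin n → ι) → ℝ)
    (I : Fin n → ι) : ContDiffOn ℝ ∞ (fun x => traceOperator (g x) Y I) U := by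
  have hprod := contDiffOn_bilinProd hg.smooth (T := fun _ => symmetrize Y)
    fun _ => contDiffOn_const
  exact (contDiffOn_metricTrace hg (contDiffOn_symmetrize hprod) I).add contDiffOn_const

theorem exists_stfPart_eq_symmetrize [Nonempty ι] (hg : IsSmoothMetricOn g U)
    {T : 𝔼 ι → (Fin (n + 2) → ι) → ℝ} (hT : ∀ I, ContDiffOn ℝ ∞ (fun x => T x I) U) :
    ∃ Z : 𝔼 ι → (Fin n → ι) → ℝ, (∀ I, ContDiffOn ℝ ∞ (fun x => Z x I) U) ∧
      ∀ x ∈ U, stfPart (g x) (T x) = symmetrize (T x - bilinProd (g x) (Z x)) := by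
  obtain ⟨Z, hZ, hsolve⟩ := exists_contDiffOn_linearMap_apply_eq (contDiffOn_traceOperator hg)
    (fun x hx => traceOperator_injective (hg.posDef x hx))
    (contDiffOn_metricTrace hg (contDiffOn_symmetrize hT))
  exact ⟨Z, hZ, fun x hx => stfPart_eq_symmetrize (hg.posDef x hx) (hsolve x hx)⟩

theorem contDiffOn_stfPart [Nonempty ι] (hg : IsSmoothMetricOn g U)
    {T : 𝔼 ι → (Fin n → ι) → ℝ} (hT : ∀ I, ContDiffOn ℝ ∞ (fun x => T x I) U)
    (I : Fin n → ι) : ContDiffOn ℝ ∞ (fun x => stfPart (g x) (T x) I) U := by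
  match n, T, hT, I with
  | 0, T, hT, I =>
    exact (hT I).congr fun x hx => by rw [(isSTF_rank_zero _).stfPart_eq_self (hg.posDef x hx)]
  | 1, T, hT, I =>
    exact (hT I).congr fun x hx => by rw [(isSTF_rank_one _).stfPart_eq_self (hg.posDef x hx)]
  | n + 2, T, hT, I =>
    obtain ⟨Z, hZ, h⟩ := exists_stfPart_eq_symmetrize hg hT
    exact (contDiffOn_symmetrize (fun J => (hT J).sub (contDiffOn_bilinProd hg.smooth hZ J))
      I).congr fun x hx => by rw [h x hx]; rfl

theorem exists_tensorEval_stfPart_eq [Nonempty ι] (hg : IsSmoothMetricOn g U)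
    {T : 𝔼 ι → (Fin n → ι) → ℝ} (hT : ∀ I, ContDiffOn ℝ ∞ (fun x => T x I) U) :
    ∃ Z : 𝔼 ι × 𝔼 ι → ℝ, ContDiffOn ℝ ∞ Z (Prod.fst ⁻¹' U) ∧
      ∀ p : 𝔼 ι × 𝔼 ι, p.1 ∈ U → tensorEval (stfPart (g p.1) (T p.1)) p.2 =
        tensorForm T p + quadForm (g p.1) p.2 * Z p := by
  match n, T, hT with
  | 0, T, _ =>
    exact ⟨fun _ => 0, contDiffOn_const, fun p hp => by
      rw [(isSTF_rank_zero _).stfPart_eq_self (hg.posDef _ hp), mul_zero, add_zero, tensorForm]⟩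
  | 1, T, _ =>
    exact ⟨fun _ => 0, contDiffOn_const, fun p hp => by
      rw [(isSTF_rank_one _).stfPart_eq_self (hg.posDef _ hp), mul_zero, add_zero, tensorForm]⟩
  | n + 2, T, hT =>
    obtain ⟨Z, hZ, h⟩ := exists_stfPart_eq_symmetrize hg hT
    refine ⟨fun p => -tensorForm Z p, (contDiffOn_tensorForm hZ).neg, fun p hp => ?_⟩
    rw [h _ hp, tensorEval_symmetrize, tensorEval_sub, tensorEval_bilinProd]
    simp only [tensorForm]
    ring

end TraceFree

/-! ### The multipole recursion modulo the metric -/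

section Moments

variable {ι : Type} [Fintype ι] [DecidableEq ι] {U : Set (𝔼 ι)} {g : 𝔼 ι → Matrix ι ι ℝ}

theorem contDiffOn_covDeriv (hg : IsSmoothMetricOn g U) {n : ℕ} {T : 𝔼 ι → (Fin n → ι) → ℝ}
    (hT : ∀ I, ContDiffOn ℝ ∞ (fun x => T x I) U) (I : Fin (n + 1) → ι) :
    ContDiffOn ℝ ∞ (fun x => covDeriv g T x I) U :=
  (contDiffOn_pderiv hg.isOpen (hT _) _).sub (ContDiffOn.sum fun _ _ => ContDiffOn.sum fun _ _ =>
    (hg.contDiffOn_christoffel _ _ _).mul (hT _))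

theorem isSTF_multipoleTensor (hg : IsSmoothMetricOn g U) (φ : 𝔼 ι → ℝ) {x : 𝔼 ι} (hx : x ∈ U) :
    ∀ n : ℕ, IsSTF (g x) (multipoleTensor g φ n x)
  | 0 => isSTF_rank_zero _
  | 1 => isSTF_stfPart (hg.posDef x hx) _
  | _ + 2 => isSTF_stfPart (hg.posDef x hx) _

variable [Nonempty ι]

theorem contDiffOn_multipoleTensor (hg : IsSmoothMetricOn g U) {φ : 𝔼 ι → ℝ}
    (hφ : ContDiffOn ℝ ∞ φ U) : ∀ (n : ℕ) (I : Fin n → ι),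
      ContDiffOn ℝ ∞ (fun x => multipoleTensor g φ n x I) U
  | 0, _ => hφ
  | 1, I => contDiffOn_stfPart hg (contDiffOn_covDeriv hg (contDiffOn_multipoleTensor hg hφ 0)) I
  | n + 2, I => contDiffOn_stfPart hg (fun J =>
      (contDiffOn_covDeriv hg (contDiffOn_multipoleTensor hg hφ (n + 1)) J).sub
        (contDiffOn_const.mul ((hg.contDiffOn_ricci _ _).mul
          (contDiffOn_multipoleTensor hg hφ n _)))) I

theorem contDiffOn_tensorForm_multipoleTensor (hg : IsSmoothMetricOn g U) {φ : 𝔼 ι → ℝ}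
    (hφ : ContDiffOn ℝ ∞ φ U) (n : ℕ) :
    ContDiffOn ℝ ∞ (tensorForm (multipoleTensor g φ n)) (Prod.fst ⁻¹' U) :=
  contDiffOn_tensorForm (contDiffOn_multipoleTensor hg hφ n)

theorem exists_tensorForm_multipoleTensor_one (hg : IsSmoothMetricOn g U) {φ : 𝔼 ι → ℝ}
    (hφ : ContDiffOn ℝ ∞ φ U) :
    ∃ Z : 𝔼 ι × 𝔼 ι → ℝ, ContDiffOn ℝ ∞ Z (Prod.fst ⁻¹' U) ∧ ∀ p : 𝔼 ι × 𝔼 ι, p.1 ∈ U →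
      tensorForm (multipoleTensor g φ 1) p =
        spray g (tensorForm (multipoleTensor g φ 0)) p + quadForm (g p.1) p.2 * Z p := by
  have hφ₀ := contDiffOn_multipoleTensor hg hφ 0
  obtain ⟨Z, hZ, h⟩ := exists_tensorEval_stfPart_eq hg (contDiffOn_covDeriv hg hφ₀)
  exact ⟨Z, hZ, fun p hp => by rw [← tensorEval_covDeriv hg hφ₀ hp]; exact h p hp⟩

theorem exists_tensorForm_multipoleTensor_add_two (hg : IsSmoothMetricOn g U) {φ : 𝔼 ι → ℝ}
    (hφ : ContDiffOn ℝ ∞ φ U) (n : ℕ) :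
    ∃ Z : 𝔼 ι × 𝔼 ι → ℝ, ContDiffOn ℝ ∞ Z (Prod.fst ⁻¹' U) ∧ ∀ p : 𝔼 ι × 𝔼 ι, p.1 ∈ U →
      tensorForm (multipoleTensor g φ (n + 2)) p =
        spray g (tensorForm (multipoleTensor g φ (n + 1))) p -
          ((n + 1 : ℝ) * (2 * n + 1) / 2) * (quadForm (Matrix.of (ricci g p.1)) p.2 *
            tensorForm (multipoleTensor g φ n) p) + quadForm (g p.1) p.2 * Z p := by
  have hφₙ := contDiffOn_multipoleTensor hg hφ n
  have hφₙ' := contDiffOn_multipoleTensor hg hφ (n + 1)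
  let ricciTerm : 𝔼 ι → (Fin (n + 2) → ι) → ℝ := fun x =>
    bilinProd (Matrix.of (ricci g x)) (multipoleTensor g φ n x)
  obtain ⟨Z, hZ, h⟩ := exists_tensorEval_stfPart_eq hg
    (T := fun x => covDeriv g (multipoleTensor g φ (n + 1)) x -
      ((n + 1 : ℝ) * (2 * n + 1) / 2) • ricciTerm x)
    fun J => (contDiffOn_covDeriv hg hφₙ' J).sub
      (contDiffOn_const.mul ((hg.contDiffOn_ricci _ _).mul (hφₙ _)))
  refine ⟨Z, hZ, fun p hp => (h p hp).trans ?_⟩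
  rw [← tensorEval_covDeriv hg hφₙ' hp, tensorForm, tensorEval_sub, tensorEval_smul,
    tensorEval_bilinProd, tensorForm]

end Moments

/-! ### Ideals of smooth functions stable under the geodesic spray -/

section SmoothIdeal

variable {κ : Type*} [Fintype κ] {E : Type*} [NormedAddCommGroup E] [NormedSpace ℝ E] {s : Set E}
  {G : κ → E → ℝ} {F F' : E → ℝ}

/-- On `s`, the function `F` is a combination of the functions `G k` with smooth coefficients,
that is, it belongs to the ideal which they generate in the ring of smooth functions on `s`. -/
def MemSmoothIdeal (s : Set E) (G : κ → E → ℝ) (F : E → ℝ) : Prop :=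
  ∃ A : κ → E → ℝ, (∀ k, ContDiffOn ℝ ∞ (A k) s) ∧ Set.EqOn F (fun p => ∑ k, G k p * A k p) s

namespace MemSmoothIdeal

theorem congr (hF : MemSmoothIdeal s G F) (h : Set.EqOn F' F s) : MemSmoothIdeal s G F' :=
  let ⟨A, hA, hFA⟩ := hF
  ⟨A, hA, h.trans hFA⟩

theorem add (hF : MemSmoothIdeal s G F) (hF' : MemSmoothIdeal s G F') :
    MemSmoothIdeal s G fun p => F p + F' p := by
  obtain ⟨A, hA, hFA⟩ := hF
  obtain ⟨A', hA', hFA'⟩ := hF'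
  refine ⟨fun k p => A k p + A' k p, fun k => (hA k).add (hA' k), fun p hp => ?_⟩
  simp only [hFA hp, hFA' hp, mul_add, Finset.sum_add_distrib]

theorem mul_left (hF : MemSmoothIdeal s G F) {c : E → ℝ} (hc : ContDiffOn ℝ ∞ c s) :
    MemSmoothIdeal s G fun p => c p * F p := by
  obtain ⟨A, hA, hFA⟩ := hF
  refine ⟨fun k p => c p * A k p, fun k => hc.mul (hA k), fun p hp => ?_⟩
  simp only [hFA hp, Finset.mul_sum, mul_left_comm]

theorem sum {κ' : Type*} [Fintype κ'] {F : κ' → E → ℝ} (hF : ∀ l, MemSmoothIdeal s G (F l)) :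
    MemSmoothIdeal s G fun p => ∑ l, F l p := by
  choose A hA hFA using hF
  refine ⟨fun k p => ∑ l, A l k p, fun k => ContDiffOn.sum fun l _ => hA l k, fun p hp => ?_⟩
  simp only [Finset.mul_sum]
  rw [Finset.sum_comm]
  exact Finset.sum_congr rfl fun l _ => hFA l hp

theorem generator (k : κ) : MemSmoothIdeal s G (G k) := by
  classical
  exact ⟨fun l _ => if l = k then 1 else 0, fun _ => contDiffOn_const, fun p _ => by simp⟩

end MemSmoothIdeal

variable {ι : Type} [Fintype ι] [DecidableEq ι] {U : Set (𝔼 ι)} {g : 𝔼 ι → Matrix ι ι ℝ}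
  {G : κ → 𝔼 ι × 𝔼 ι → ℝ}

theorem memSmoothIdeal_spray (hg : IsSmoothMetricOn g U)
    (hG : ∀ k, ContDiffOn ℝ ∞ (G k) (Prod.fst ⁻¹' U))
    (hstable : ∀ k, MemSmoothIdeal (Prod.fst ⁻¹' U) G (spray g (G k))) {F : 𝔼 ι × 𝔼 ι → ℝ}
    (hF : MemSmoothIdeal (Prod.fst ⁻¹' U) G F) :
    MemSmoothIdeal (Prod.fst ⁻¹' U) G (spray g F) := by
  obtain ⟨A, hA, hFA⟩ := hF
  refine (MemSmoothIdeal.sum fun k => ((hstable k).mul_left (hA k)).add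
    ((MemSmoothIdeal.generator k).mul_left (contDiffOn_spray hg (hA k)))).congr fun p hp => ?_
  have hG' k := differentiableAt_tangent hg.isOpen (hG k) hp
  have hA' k := differentiableAt_tangent hg.isOpen (hA k) hp
  rw [spray_congr hg.isOpen hFA hp, spray_sum _ fun k _ => (hG' k).fun_mul (hA' k)]
  refine Finset.sum_congr rfl fun k _ => ?_
  rw [spray_mul (hG' k) (hA' k)]
  ring

/-- Modulo an ideal which contains the metric form, the recursion for the contracted moments
involves neither the trace-free part nor a symmetrization. -/
theorem memSmoothIdeal_multipoleTensor_sub [Nonempty ι] (hg : IsSmoothMetricOn g U)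
    (hG : ∀ k, ContDiffOn ℝ ∞ (G k) (Prod.fst ⁻¹' U))
    (hstable : ∀ k, MemSmoothIdeal (Prod.fst ⁻¹' U) G (spray g (G k)))
    (hmetric : MemSmoothIdeal (Prod.fst ⁻¹' U) G fun p => quadForm (g p.1) p.2)
    {φ ψ : 𝔼 ι → ℝ} (hφ : ContDiffOn ℝ ∞ φ U) (hψ : ContDiffOn ℝ ∞ ψ U)
    (hφψ : MemSmoothIdeal (Prod.fst ⁻¹' U) G fun p => φ p.1 - ψ p.1) (n : ℕ) :
    MemSmoothIdeal (Prod.fst ⁻¹' U) G fun p =>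
      tensorForm (multipoleTensor g φ n) p - tensorForm (multipoleTensor g ψ n) p := by
  have rank_zero : MemSmoothIdeal (Prod.fst ⁻¹' U) G fun p =>
      tensorForm (multipoleTensor g φ 0) p - tensorForm (multipoleTensor g ψ 0) p := by
    simpa only [tensorForm, tensorEval_rank_zero, multipoleTensor] using hφψ
  have spray_diff (m : ℕ)
      (hm : MemSmoothIdeal (Prod.fst ⁻¹' U) G fun p =>
        tensorForm (multipoleTensor g φ m) p - tensorForm (multipoleTensor g ψ m) p) :
      MemSmoothIdeal (Prod.fst ⁻¹' U) G fun p =>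
        spray g (tensorForm (multipoleTensor g φ m)) p -
          spray g (tensorForm (multipoleTensor g ψ m)) p :=
    (memSmoothIdeal_spray hg hG hstable hm).congr fun p hp => (spray_sub
      (differentiableAt_tangent hg.isOpen (contDiffOn_tensorForm_multipoleTensor hg hφ m) hp)
      (differentiableAt_tangent hg.isOpen (contDiffOn_tensorForm_multipoleTensor hg hψ m) hp)).symm
  induction n using Nat.twoStepInduction with
  | zero => exact rank_zero
  | one =>
    obtain ⟨Z, hZ, hφZ⟩ := exists_tensorForm_multipoleTensor_one hg hφ
    obtain ⟨Z', hZ', hψZ'⟩ := exists_tensorForm_multipoleTensor_one hg hψ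
    refine ((spray_diff 0 rank_zero).add (hmetric.mul_left (hZ.sub hZ'))).congr fun p hp => ?_
    rw [hφZ p hp, hψZ' p hp]
    ring
  | more n ih ih' =>
    obtain ⟨Z, hZ, hφZ⟩ := exists_tensorForm_multipoleTensor_add_two hg hφ n
    obtain ⟨Z', hZ', hψZ'⟩ := exists_tensorForm_multipoleTensor_add_two hg hψ n
    have hricci : ContDiffOn ℝ ∞
        (fun p : 𝔼 ι × 𝔼 ι => -((n + 1 : ℝ) * (2 * n + 1) / 2) *
          quadForm (Matrix.of (ricci g p.1)) p.2) (Prod.fst ⁻¹' U) :=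
      contDiffOn_const.mul (contDiffOn_quadForm hg.contDiffOn_ricci)
    refine (((spray_diff (n + 1) ih').add (ih.mul_left hricci)).add
      (hmetric.mul_left (hZ.sub hZ'))).congr fun p hp => ?_
    rw [hφZ p hp, hψZ' p hp]
    ring

end SmoothIdeal

/-! ### Moments at a critical zero of the conformal factor -/

section CriticalZero

variable {ι : Type} [Fintype ι] {U : Set (𝔼 ι)} {g : 𝔼 ι → Matrix ι ι ℝ}

/-- The conformal factor, its differential and the metric, as functions on the tangent bundle. -/
def jetGenerators (g : 𝔼 ι → Matrix ι ι ℝ) (Ω : 𝔼 ι → ℝ) : Fin 3 → 𝔼 ι × 𝔼 ι → ℝ :=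
  ![fun p => Ω p.1, diffForm Ω, fun p => quadForm (g p.1) p.2]

theorem contDiffOn_jetGenerators (hg : IsSmoothMetricOn g U) {Ω : 𝔼 ι → ℝ}
    (hΩ : ContDiffOn ℝ ∞ Ω U) (k : Fin 3) :
    ContDiffOn ℝ ∞ (jetGenerators g Ω k) (Prod.fst ⁻¹' U) := by
  fin_cases k
  · exact contDiffOn_comp_fst hΩ
  · exact contDiffOn_diffForm hg.isOpen hΩ
  · exact contDiffOn_quadForm hg.smooth

variable [DecidableEq ι]

/-- The Hessian `D_i D_j f` of `f` with respect to `g`. -/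
def covHessian (g : 𝔼 ι → Matrix ι ι ℝ) (f : 𝔼 ι → ℝ) (x : 𝔼 ι) : Matrix ι ι ℝ :=
  Matrix.of fun i j => pderiv i (pderiv j f) x - ∑ k, christoffel g k i j x * pderiv k f x

theorem contDiffOn_covHessian (hg : IsSmoothMetricOn g U) {f : 𝔼 ι → ℝ} (hf : ContDiffOn ℝ ∞ f U)
    (i j : ι) : ContDiffOn ℝ ∞ (fun x => covHessian g f x i j) U :=
  (contDiffOn_pderiv hg.isOpen (contDiffOn_pderiv hg.isOpen hf j) i).sub
    (ContDiffOn.sum fun k _ =>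
      (hg.contDiffOn_christoffel k i j).mul (contDiffOn_pderiv hg.isOpen hf k))

theorem spray_diffForm (hg : IsSmoothMetricOn g U) {f : 𝔼 ι → ℝ} (hf : ContDiffOn ℝ ∞ f U)
    {p : 𝔼 ι × 𝔼 ι} (hp : p.1 ∈ U) :
    spray g (diffForm f) p = quadForm (covHessian g f p.1) p.2 := by
  let df : 𝔼 ι → (Fin 1 → ι) → ℝ := fun x I => pderiv (I 0) f x
  have diffForm_eq : diffForm f = tensorForm df := by
    funext q
    rw [diffForm, fderiv_eq_sum_pderiv, tensorForm, tensorEval_rank_one fun i => pderiv i f q.1]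
  rw [diffForm_eq, ← tensorEval_covDeriv hg (T := df)
    (fun I => contDiffOn_pderiv hg.isOpen hf (I 0)) hp, ← tensorEval_rank_two]
  congr 1
  funext I
  simp [covDeriv, covHessian, df, Fin.tail]

theorem memSmoothIdeal_spray_jetGenerators (hg : IsSmoothMetricOn g U) {Ω : 𝔼 ι → ℝ}
    (hΩ : ContDiffOn ℝ ∞ Ω U)
    (hess : MemSmoothIdeal (Prod.fst ⁻¹' U) (jetGenerators g Ω) fun p =>
      quadForm (covHessian g Ω p.1) p.2) (k : Fin 3) :
    MemSmoothIdeal (Prod.fst ⁻¹' U) (jetGenerators g Ω) (spray g (jetGenerators g Ω k)) := by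
  fin_cases k
  · exact (MemSmoothIdeal.generator 1).congr fun p hp =>
      spray_comp_fst (differentiableAt_of_contDiffOn hg.isOpen hΩ hp)
  · exact hess.congr fun p hp => spray_diffForm hg hΩ hp
  · exact ((MemSmoothIdeal.generator 2).mul_left (contDiffOn_const (c := 0))).congr
      fun p hp => (spray_quadForm_metric hg hp).trans (zero_mul _).symm

theorem multipoleTensor_eq_of_sub_eq_mul [Nonempty ι] (hg : IsSmoothMetricOn g U)
    {Ω f φ ψ : 𝔼 ι → ℝ} (hΩ : ContDiffOn ℝ ∞ Ω U) (hf : ContDiffOn ℝ ∞ f U)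
    (hφ : ContDiffOn ℝ ∞ φ U) (hψ : ContDiffOn ℝ ∞ ψ U)
    (hφψ : ∀ x ∈ U, φ x - ψ x = f x * Ω x)
    (hess : MemSmoothIdeal (Prod.fst ⁻¹' U) (jetGenerators g Ω) fun p =>
      quadForm (covHessian g Ω p.1) p.2)
    {x₀ : 𝔼 ι} (hx₀ : x₀ ∈ U) (hΩ₀ : Ω x₀ = 0) (hdΩ₀ : ∀ i, pderiv i Ω x₀ = 0) (n : ℕ) :
    multipoleTensor g φ n x₀ = multipoleTensor g ψ n x₀ := by
  obtain ⟨A, hA, hφψA⟩ := memSmoothIdeal_multipoleTensor_sub hg (contDiffOn_jetGenerators hg hΩ)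
    (memSmoothIdeal_spray_jetGenerators hg hΩ hess) (MemSmoothIdeal.generator 2) hφ hψ
    (((MemSmoothIdeal.generator 0).mul_left (contDiffOn_comp_fst hf)).congr
      fun p hp => hφψ p.1 hp) n
  have hA₀ : ContDiff ℝ ∞ fun v => A 2 (x₀, v) := contDiffOn_univ.mp
    ((hA 2).comp (contDiff_const.prodMk contDiff_id).contDiffOn fun v _ => hx₀)
  have hdΩ (v : 𝔼 ι) : diffForm Ω (x₀, v) = 0 := by simp [diffForm, fderiv_eq_sum_pderiv, hdΩ₀]
  refine sub_eq_zero.mp (IsSTF.eq_zero_of_tensorEval_eq (hg.posDef x₀ hx₀)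
    ((stfSubmodule (g x₀) n).sub_mem (isSTF_multipoleTensor hg φ hx₀ n)
      (isSTF_multipoleTensor hg ψ hx₀ n)) hA₀ fun v => ?_)
  rw [tensorEval_sub]
  refine (hφψA (x := (x₀, v)) hx₀).trans ?_
  simp [Fin.sum_univ_three, jetGenerators, hΩ₀, hdΩ]

end CriticalZero

/-! ### Conformal changes of the metric -/

section ConformalShift

variable {ι R : Type*} [DecidableEq ι] [CommRing R] {G : Matrix ι ι R} {σ ρ : ι → R}

/-- The tensor `δ^k_i σ_j + δ^k_j σ_i - G_{ij} ρ^k`. For `σ = ds` and `ρ` the gradient of `s`, it is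
the difference of the Christoffel symbols of the metrics `exp (2 s) G` and `G`. -/
def conformalShift (G : Matrix ι ι R) (σ ρ : ι → R) (k i j : ι) : R :=
  (if k = i then σ j else 0) + (if k = j then σ i else 0) - G i j * ρ k

theorem conformalShift_symm (hG : ∀ i j, G i j = G j i) (k i j : ι) :
    conformalShift G σ ρ k i j = conformalShift G σ ρ k j i := by
  rw [conformalShift, conformalShift, hG i j, add_comm (ite _ _ _)]

variable [Fintype ι]

theorem sum_mul_conformalShift (A : ι → R) (i j : ι) :
    ∑ k, A k * conformalShift G σ ρ k i j = A i * σ j + A j * σ i - G i j * ∑ k, A k * ρ k := by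
  simp only [conformalShift, mul_add, mul_sub, Finset.sum_add_distrib, Finset.sum_sub_distrib,
    mul_ite, mul_zero, Finset.sum_ite_eq', Finset.mem_univ, if_true, Finset.mul_sum, mul_left_comm]

theorem sum_conformalShift_diag (hσ : ∀ i, ∑ k, G i k * ρ k = σ i) (i : ι) :
    ∑ k, conformalShift G σ ρ k i k = Fintype.card ι * σ i := by
  simp [conformalShift, Finset.sum_add_distrib, Finset.sum_sub_distrib, hσ]

theorem sum_conformalShift_trace (hG : ∀ i j, G i j = G j i) (hσ : ∀ i, ∑ k, G i k * ρ k = σ i)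
    (i : ι) : ∑ k, conformalShift G σ ρ k k i = Fintype.card ι * σ i := by
  rw [← sum_conformalShift_diag hσ]
  exact Finset.sum_congr rfl fun k _ => conformalShift_symm hG k k i

variable {Γ : ι → ι → ι → R}

theorem sum_sum_mul_conformalShift (hΓ : ∀ k i j, Γ k i j = Γ k j i) (i j : ι) :
    ∑ k, ∑ l, Γ k j l * conformalShift G σ ρ l i k =
      ∑ k, Γ k i j * σ k + (∑ k, Γ k k j) * σ i - ∑ k, ρ k * ∑ l, G i l * Γ l k j := by
  simp only [sum_mul_conformalShift, Finset.sum_add_distrib, Finset.sum_sub_distrib,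
    Finset.mul_sum, Finset.sum_mul]
  rw [Finset.sum_comm (f := fun k l => G i k * (Γ k j l * ρ l))]
  simp only [hΓ _ j _]
  congr 1
  exact Finset.sum_congr rfl fun _ _ => Finset.sum_congr rfl fun _ _ => by ring

theorem sum_sum_conformalShift_mul_self (hG : ∀ i j, G i j = G j i)
    (hσ : ∀ i, ∑ k, G i k * ρ k = σ i) (i j : ι) :
    ∑ k, ∑ l, conformalShift G σ ρ k j l * conformalShift G σ ρ l i k =
      (Fintype.card ι + 2) * (σ i * σ j) - 2 * G i j * ∑ k, σ k * ρ k := by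
  have lowered (k : ι) : ∑ l, G i l * conformalShift G σ ρ l k j =
      G i k * σ j + G i j * σ k - G k j * σ i := by rw [sum_mul_conformalShift, hσ]
  have sum_lowered : ∑ k, ρ k * (G i k * σ j + G i j * σ k - G k j * σ i) =
      G i j * ∑ k, σ k * ρ k := by
    calc ∑ k, ρ k * (G i k * σ j + G i j * σ k - G k j * σ i)
        = (∑ k, G i k * ρ k) * σ j + G i j * ∑ k, σ k * ρ k - (∑ k, G j k * ρ k) * σ i := by
          simp only [Finset.sum_mul, Finset.mul_sum, ← Finset.sum_add_distrib,
            ← Finset.sum_sub_distrib, hG j]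
          exact Finset.sum_congr rfl fun k _ => by ring
      _ = G i j * ∑ k, σ k * ρ k := by rw [hσ, hσ]; ring
  have contracted : ∑ k, conformalShift G σ ρ k i j * σ k =
      2 * (σ i * σ j) - G i j * ∑ k, σ k * ρ k := by
    rw [Finset.sum_congr rfl fun k _ => mul_comm _ (σ k), sum_mul_conformalShift]
    ring
  rw [sum_sum_mul_conformalShift (conformalShift_symm hG), contracted,
    sum_conformalShift_trace hG hσ]
  simp only [lowered, sum_lowered]
  ring

theorem sum_sum_trace_mul_conformalShift (hG : ∀ i j, G i j = G j i)
    (hσ : ∀ i, ∑ k, G i k * ρ k = σ i) (i j : ι) :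
    ∑ k, ∑ l, (Γ k k l + conformalShift G σ ρ k k l) * (Γ l i j + conformalShift G σ ρ l i j) =
      ∑ k, ∑ l, Γ k k l * Γ l i j + Fintype.card ι * ∑ k, Γ k i j * σ k +
        ((∑ k, Γ k k i) * σ j + (∑ k, Γ k k j) * σ i - G i j * ∑ k, ∑ l, Γ k k l * ρ l) +
        Fintype.card ι * (2 * (σ i * σ j) - G i j * ∑ k, σ k * ρ k) := by
  rw [Finset.sum_comm, Finset.sum_comm (f := fun k l => Γ k k l * Γ l i j),
    Finset.sum_comm (f := fun k l => Γ k k l * ρ l)]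
  simp only [← Finset.sum_mul, Finset.sum_add_distrib, sum_conformalShift_trace hG hσ, mul_add,
    add_mul, sum_mul_conformalShift, mul_assoc, ← Finset.mul_sum, mul_comm (Γ _ i j)]
  ring

/-- The expression quadratic in the Christoffel symbols which occurs in the Ricci tensor, for the
Christoffel symbols of a conformally changed metric. -/
theorem quadratic_add_conformalShift (hG : ∀ i j, G i j = G j i)
    (hσ : ∀ i, ∑ k, G i k * ρ k = σ i) (hΓ : ∀ k i j, Γ k i j = Γ k j i) (i j : ι) :
    ∑ k, ∑ l,
        ((Γ k k l + conformalShift G σ ρ k k l) * (Γ l i j + conformalShift G σ ρ l i j) -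
          (Γ k j l + conformalShift G σ ρ k j l) * (Γ l i k + conformalShift G σ ρ l i k)) =
      ∑ k, ∑ l, (Γ k k l * Γ l i j - Γ k j l * Γ l i k) +
        (Fintype.card ι - 2) * (∑ k, Γ k i j * σ k + σ i * σ j) +
        ∑ k, ρ k * (∑ l, G j l * Γ l k i + ∑ l, G i l * Γ l k j) -
        (∑ k, ∑ l, Γ k k l * ρ l + (Fintype.card ι - 2) * ∑ k, σ k * ρ k) * G i j := by
  have cross' : ∑ k, ∑ l, conformalShift G σ ρ k j l * Γ l i k =
      ∑ k, Γ k i j * σ k + (∑ k, Γ k k i) * σ j - ∑ k, ρ k * ∑ l, G j l * Γ l k i := by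
    rw [Finset.sum_comm]
    simp only [mul_comm (conformalShift _ _ _ _ _ _), sum_sum_mul_conformalShift hΓ, hΓ _ j i]
  simp only [Finset.sum_sub_distrib, sum_sum_trace_mul_conformalShift hG hσ]
  simp only [add_mul, mul_add, Finset.sum_add_distrib, sum_sum_mul_conformalShift hΓ, cross',
    sum_sum_conformalShift_mul_self hG hσ]
  ring

end ConformalShift

section Conformal

variable {ι : Type} [Fintype ι] [DecidableEq ι] {U : Set (𝔼 ι)} {g : 𝔼 ι → Matrix ι ι ℝ} {x : 𝔼 ι}
  {s : 𝔼 ι → ℝ}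

/-- The component `D^k s` of the gradient of `s` with respect to `g`. -/
def metricGradient (g : 𝔼 ι → Matrix ι ι ℝ) (s : 𝔼 ι → ℝ) (k : ι) (x : 𝔼 ι) : ℝ :=
  ∑ l, (g x)⁻¹ k l * pderiv l s x

/-- The Laplacian of `s` with respect to `g`, as the divergence `∂_k D^k s + Γ^k_{kl} D^l s`. -/
def laplacian (g : 𝔼 ι → Matrix ι ι ℝ) (s : 𝔼 ι → ℝ) (x : 𝔼 ι) : ℝ :=
  ∑ k, pderiv k (metricGradient g s k) x +
    ∑ k, ∑ l, christoffel g k k l x * metricGradient g s l x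

namespace IsSmoothMetricOn

theorem contDiffOn_metricGradient (hg : IsSmoothMetricOn g U) (hs : ContDiffOn ℝ ∞ s U) (k : ι) :
    ContDiffOn ℝ ∞ (metricGradient g s k) U :=
  ContDiffOn.sum fun l _ => (hg.contDiffOn_inv k l).mul (contDiffOn_pderiv hg.isOpen hs l)

theorem sum_mul_metricGradient (hg : IsSmoothMetricOn g U) (hx : x ∈ U) (s : 𝔼 ι → ℝ) (i : ι) :
    ∑ k, g x i k * metricGradient g s k x = pderiv i s x := by
  simp only [metricGradient, Finset.mul_sum]
  rw [Finset.sum_comm]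
  simp only [← mul_assoc, ← Finset.sum_mul, hg.sum_mul_inv hx, ite_mul, one_mul, zero_mul,
    Finset.sum_ite_eq, Finset.mem_univ, if_true]

end IsSmoothMetricOn

theorem pderiv_exp_smul_apply (hs : DifferentiableAt ℝ s x) {a b : ι}
    (hg : DifferentiableAt ℝ (fun y => g y a b) x) (i : ι) :
    pderiv i (fun y => (Real.exp (2 * s y) • g y) a b) x =
      Real.exp (2 * s x) * (2 * pderiv i s x * g x a b + pderiv i (fun y => g y a b) x) := by
  have hexp : HasDerivAt (fun r => Real.exp (2 * r)) (2 * Real.exp (2 * s x)) (s x) := by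
    simpa [mul_comm] using ((hasDerivAt_id (s x)).const_mul 2).exp
  simp only [Matrix.smul_apply, smul_eq_mul]
  rw [pderiv_mul (hs.const_mul 2).exp hg, pderiv_comp hs hexp]
  ring

theorem christoffel_exp_smul (hg : IsSmoothMetricOn g U) (hs : ContDiffOn ℝ ∞ s U) (hx : x ∈ U)
    (k i j : ι) :
    christoffel (fun y => Real.exp (2 * s y) • g y) k i j x = christoffel g k i j x +
      conformalShift (g x) (fun i => pderiv i s x) (fun k => metricGradient g s k x) k i j := by
  have hds := differentiableAt_of_contDiffOn hg.isOpen hs hx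
  have hdg (a b : ι) := differentiableAt_of_contDiffOn hg.isOpen (hg.smooth a b) hx
  have hne : Real.exp (2 * s x) ≠ 0 := (Real.exp_pos _).ne'
  have inv_eq : (Real.exp (2 * s x) • g x)⁻¹ = (Real.exp (2 * s x))⁻¹ • (g x)⁻¹ :=
    Matrix.inv_eq_right_inv (by rw [Matrix.smul_mul, Matrix.mul_smul, smul_smul,
      mul_inv_cancel₀ hne, one_smul, Matrix.mul_nonsing_inv _ (hg.isUnit_det hx)])
  have sum_inv_mul' (a : ι) : ∑ l, (g x)⁻¹ k l * g x a l = if k = a then 1 else 0 := by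
    simp only [hg.symm hx a, hg.sum_inv_mul hx]
  have summand (l : ι) : (Real.exp (2 * s x) • g x)⁻¹ k l *
      (pderiv i (fun y => (Real.exp (2 * s y) • g y) j l) x +
        pderiv j (fun y => (Real.exp (2 * s y) • g y) i l) x -
        pderiv l (fun y => (Real.exp (2 * s y) • g y) i j) x) =
      (g x)⁻¹ k l * (pderiv i (fun y => g y j l) x + pderiv j (fun y => g y i l) x -
        pderiv l (fun y => g y i j) x) + (2 * pderiv i s x * ((g x)⁻¹ k l * g x j l) +
        2 * pderiv j s x * ((g x)⁻¹ k l * g x i l) -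
        2 * g x i j * ((g x)⁻¹ k l * pderiv l s x)) := by
    rw [pderiv_exp_smul_apply hds (hdg _ _), pderiv_exp_smul_apply hds (hdg _ _),
      pderiv_exp_smul_apply hds (hdg _ _), inv_eq, Matrix.smul_apply, smul_eq_mul]
    field_simp
    ring
  rw [christoffel, Finset.sum_congr rfl fun l _ => summand l, Finset.sum_add_distrib, mul_add,
    ← christoffel, Finset.sum_sub_distrib, Finset.sum_add_distrib]
  simp only [← Finset.mul_sum, sum_inv_mul', metricGradient, conformalShift]
  split_ifs <;> ring

theorem pderiv_christoffel_exp_smul (hg : IsSmoothMetricOn g U) (hs : ContDiffOn ℝ ∞ s U)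
    (hx : x ∈ U) (m k i j : ι) :
    pderiv m (christoffel (fun y => Real.exp (2 * s y) • g y) k i j) x =
      pderiv m (christoffel g k i j) x + ((if k = i then pderiv m (pderiv j s) x else 0) +
        (if k = j then pderiv m (pderiv i s) x else 0) -
        (pderiv m (fun y => g y i j) x * metricGradient g s k x +
          g x i j * pderiv m (metricGradient g s k) x)) := by
  have hdiff {f : 𝔼 ι → ℝ} (hf : ContDiffOn ℝ ∞ f U) : DifferentiableAt ℝ f x :=
    differentiableAt_of_contDiffOn hg.isOpen hf hx
  have hds (i : ι) := hdiff (contDiffOn_pderiv hg.isOpen hs i)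
  have hgrad := hdiff (hg.contDiffOn_metricGradient hs k)
  have hdite (P : Prop) [Decidable P] (i : ι) :
      DifferentiableAt ℝ (fun y => if P then pderiv i s y else 0) x := by
    split_ifs
    exacts [hds i, differentiableAt_const _]
  have pderiv_ite (P : Prop) [Decidable P] (f : 𝔼 ι → ℝ) :
      pderiv m (fun y => if P then f y else 0) x = if P then pderiv m f x else 0 := by
    split_ifs <;> simp [pderiv]
  rw [pderiv_congr hg.isOpen (fun y hy => christoffel_exp_smul hg hs hy k i j) hx]
  simp only [conformalShift]
  rw [pderiv_add (hdiff (hg.contDiffOn_christoffel k i j))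
      (((hdite _ j).fun_add (hdite _ i)).fun_sub ((hdiff (hg.smooth i j)).fun_mul hgrad)),
    pderiv_sub ((hdite _ j).fun_add (hdite _ i)) ((hdiff (hg.smooth i j)).fun_mul hgrad),
    pderiv_add (hdite _ j) (hdite _ i), pderiv_ite, pderiv_ite,
    pderiv_mul (hdiff (hg.smooth i j)) hgrad]

theorem sum_pderiv_christoffel_exp_smul (hg : IsSmoothMetricOn g U) (hs : ContDiffOn ℝ ∞ s U)
    (hx : x ∈ U) (i j : ι) :
    ∑ k, pderiv k (christoffel (fun y => Real.exp (2 * s y) • g y) k i j) x =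
      ∑ k, pderiv k (christoffel g k i j) x + 2 * pderiv i (pderiv j s) x -
        ∑ k, metricGradient g s k x *
          (∑ l, g x j l * christoffel g l k i x + ∑ l, g x i l * christoffel g l k j x) -
        g x i j * ∑ k, pderiv k (metricGradient g s k) x := by
  have hs₂ : ContDiffAt ℝ 2 s x :=
    (hs.contDiffAt (hg.isOpen.mem_nhds hx)).of_le (by norm_cast)
  simp only [pderiv_christoffel_exp_smul hg hs hx, Finset.sum_add_distrib, Finset.sum_sub_distrib,
    Finset.sum_ite_eq', Finset.mem_univ, if_true, hg.pderiv_eq_sum_christoffel hx,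
    ← Finset.mul_sum, pderiv_comm hs₂ j i, mul_comm _ (metricGradient _ _ _ _)]
  ring

theorem sum_pderiv_christoffel_diag_exp_smul (hg : IsSmoothMetricOn g U)
    (hs : ContDiffOn ℝ ∞ s U) (hx : x ∈ U) (i j : ι) :
    ∑ k, pderiv j (christoffel (fun y => Real.exp (2 * s y) • g y) k i k) x =
      ∑ k, pderiv j (christoffel g k i k) x + Fintype.card ι * pderiv j (pderiv i s) x := by
  have hdiff {f : 𝔼 ι → ℝ} (hf : ContDiffOn ℝ ∞ f U) : DifferentiableAt ℝ f x :=
    differentiableAt_of_contDiffOn hg.isOpen hf hx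
  have hΓ (k : ι) := hdiff (hg.contDiffOn_christoffel k i k)
  have hds := hdiff (contDiffOn_pderiv hg.isOpen hs i)
  rw [← pderiv_sum _ fun k _ => hdiff ((hg.exp_smul hs).contDiffOn_christoffel k i k),
    ← pderiv_sum _ fun k _ => hΓ k, ← pderiv_const_mul hds,
    ← pderiv_add (DifferentiableAt.fun_sum fun k _ => hΓ k) (hds.const_mul _)]
  refine pderiv_congr hg.isOpen (fun y hy => ?_) hx j
  simp only [christoffel_exp_smul hg hs hy, Finset.sum_add_distrib,
    sum_conformalShift_diag (hg.sum_mul_metricGradient hy s)]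

theorem ricci_exp_smul (hg : IsSmoothMetricOn g U) (hs : ContDiffOn ℝ ∞ s U) (hx : x ∈ U)
    (i j : ι) :
    ricci (fun y => Real.exp (2 * s y) • g y) x i j = ricci g x i j -
      (Fintype.card ι - 2) * (covHessian g s x i j - pderiv i s x * pderiv j s x) -
      (laplacian g s x + (Fintype.card ι - 2) * ∑ k, pderiv k s x * metricGradient g s k x) *
        g x i j := by
  have hs₂ : ContDiffAt ℝ 2 s x :=
    (hs.contDiffAt (hg.isOpen.mem_nhds hx)).of_le (by norm_cast)
  have quadratic_part := quadratic_add_conformalShift (Γ := fun k i j => christoffel g k i j x)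
    (hg.symm hx) (hg.sum_mul_metricGradient hx s) (hg.christoffel_symm hx) i j
  simp only [← christoffel_exp_smul hg hs hx] at quadratic_part
  simp only [ricci, Finset.sum_sub_distrib (f := fun k => pderiv k _ x),
    sum_pderiv_christoffel_exp_smul hg hs hx, sum_pderiv_christoffel_diag_exp_smul hg hs hx,
    quadratic_part, covHessian, Matrix.of_apply, laplacian, pderiv_comm hs₂ j i]
  ring

end Conformal

/-! ### The Ricci tensor of a static metric -/

section Static

/-- The projection of spacetime coordinates `(t, x)` to `x`. -/
def spaceProj : 𝔼 (Fin 4) →L[ℝ] 𝔼 (Fin 3) :=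
  LinearMap.toContinuousLinearMap
    { toFun := fun y => WithLp.toLp 2 fun i => y i.succ
      map_add' := fun _ _ => rfl
      map_smul' := fun _ _ => rfl }

theorem spaceProj_apply (y : 𝔼 (Fin 4)) (i : Fin 3) : spaceProj y i = y i.succ := rfl

theorem spaceProj_surjective : Function.Surjective spaceProj := fun x =>
  ⟨WithLp.toLp 2 (Fin.cons 0 x.ofLp), by ext i; simp [spaceProj_apply]⟩

theorem spaceProj_single_zero : spaceProj (EuclideanSpace.single 0 1) = 0 := by
  ext i
  simp [spaceProj_apply]

theorem spaceProj_single_succ (i : Fin 3) :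
    spaceProj (EuclideanSpace.single i.succ 1) = EuclideanSpace.single i 1 := by
  ext j
  simp [spaceProj_apply]

variable {f : 𝔼 (Fin 3) → ℝ} {y : 𝔼 (Fin 4)}

theorem fderiv_comp_spaceProj (hf : DifferentiableAt ℝ f (spaceProj y)) (v : 𝔼 (Fin 4)) :
    fderiv ℝ (fun z => f (spaceProj z)) y v = fderiv ℝ f (spaceProj y) (spaceProj v) :=
  congrArg (· v) (hf.hasFDerivAt.comp y spaceProj.hasFDerivAt).fderiv

theorem pderiv_zero_comp_spaceProj (hf : DifferentiableAt ℝ f (spaceProj y)) :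
    pderiv 0 (fun z => f (spaceProj z)) y = 0 := by
  rw [pderiv, fderiv_comp_spaceProj hf, spaceProj_single_zero, map_zero]

theorem pderiv_succ_comp_spaceProj (hf : DifferentiableAt ℝ f (spaceProj y)) (i : Fin 3) :
    pderiv i.succ (fun z => f (spaceProj z)) y = pderiv i f (spaceProj y) := by
  rw [pderiv, fderiv_comp_spaceProj hf, spaceProj_single_succ, pderiv]

/-- The spatial part `λ⁻¹ h` of the static metric `-λ dt² + λ⁻¹ h`. -/
def spatialMetric (lam : 𝔼 (Fin 3) → ℝ) (h : 𝔼 (Fin 3) → Matrix (Fin 3) (Fin 3) ℝ)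
    (x : 𝔼 (Fin 3)) : Matrix (Fin 3) (Fin 3) ℝ :=
  (lam x)⁻¹ • h x

variable {lam : 𝔼 (Fin 3) → ℝ} {h : 𝔼 (Fin 3) → Matrix (Fin 3) (Fin 3) ℝ}

@[simp]
theorem staticMetric_zero_zero : staticMetric lam h y 0 0 = -lam (spaceProj y) := rfl

@[simp]
theorem staticMetric_zero_succ (i : Fin 3) : staticMetric lam h y 0 i.succ = 0 := rfl

@[simp]
theorem staticMetric_succ_zero (i : Fin 3) : staticMetric lam h y i.succ 0 = 0 := rfl

@[simp]
theorem staticMetric_succ_succ (i j : Fin 3) :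
    staticMetric lam h y i.succ j.succ = spatialMetric lam h (spaceProj y) i j := rfl

theorem spatialMetric_mul_inv {x : 𝔼 (Fin 3)} (hlam : lam x ≠ 0) (hh : IsUnit (h x).det) :
    spatialMetric lam h x * spatialMetric (fun x => (lam x)⁻¹) (fun x => (h x)⁻¹) x = 1 := by
  rw [spatialMetric, spatialMetric, Matrix.smul_mul, Matrix.mul_smul, smul_smul, inv_inv,
    inv_mul_cancel₀ hlam, one_smul, Matrix.mul_nonsing_inv _ hh]

theorem spatialMetric_inv {x : 𝔼 (Fin 3)} (hlam : lam x ≠ 0) (hh : IsUnit (h x).det) :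
    (spatialMetric lam h x)⁻¹ = spatialMetric (fun x => (lam x)⁻¹) (fun x => (h x)⁻¹) x :=
  Matrix.inv_eq_right_inv (spatialMetric_mul_inv hlam hh)

theorem staticMetric_inv (hlam : lam (spaceProj y) ≠ 0) (hh : IsUnit (h (spaceProj y)).det) :
    (staticMetric lam h y)⁻¹ = staticMetric (fun x => (lam x)⁻¹) (fun x => (h x)⁻¹) y := by
  refine Matrix.inv_eq_right_inv ?_
  ext a b
  rw [Matrix.mul_apply, Fin.sum_univ_succ]
  cases a using Fin.cases <;> cases b using Fin.cases
  · simp [hlam]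
  · simp [(Fin.succ_ne_zero _).symm]
  · simp
  · simp [← Matrix.mul_apply, spatialMetric_mul_inv hlam hh, Matrix.one_apply]

theorem pderiv_staticMetric_zero_succ (a : Fin 4) (i : Fin 3) :
    pderiv a (fun z => staticMetric lam h z 0 i.succ) y = 0 := by
  simp [pderiv]

theorem pderiv_staticMetric_succ_zero (a : Fin 4) (i : Fin 3) :
    pderiv a (fun z => staticMetric lam h z i.succ 0) y = 0 := by
  simp [pderiv]

theorem pderiv_succ_staticMetric_zero_zero (hlam : DifferentiableAt ℝ lam (spaceProj y))
    (hlam₀ : lam (spaceProj y) ≠ 0) (i : Fin 3) :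
    pderiv i.succ (fun z => staticMetric lam h z 0 0) y =
      -(lam (spaceProj y) * pderiv i (fun x => Real.log (lam x)) (spaceProj y)) := by
  rw [pderiv_comp hlam (Real.hasDerivAt_log hlam₀), mul_inv_cancel_left₀ hlam₀]
  refine (pderiv_succ_comp_spaceProj hlam.fun_neg i).trans ?_
  rw [pderiv_comp hlam (hasDerivAt_neg _), neg_one_mul]

variable {U : Set (𝔼 (Fin 3))}

theorem IsSmoothMetricOn.spatialMetric (hh : IsSmoothMetricOn h U) (hlam : ContDiffOn ℝ ∞ lam U)
    (hlam₀ : ∀ x ∈ U, 0 < lam x) : IsSmoothMetricOn (spatialMetric lam h) U := by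
  have hlog : ContDiffOn ℝ ∞ (fun x => -(1 / 2) * Real.log (lam x)) U :=
    contDiffOn_const.mul (hlam.log fun x hx => (hlam₀ x hx).ne')
  refine (hh.exp_smul hlog).congr fun x hx => ?_
  have hexp : Real.exp (2 * (-(1 / 2) * Real.log (lam x))) = (lam x)⁻¹ := by
    rw [← Real.exp_log (inv_pos.mpr (hlam₀ x hx)), Real.log_inv]
    ring_nf
  rw [Multipole.spatialMetric, ← hexp]

variable (hh : IsSmoothMetricOn h U) (hlam : ContDiffOn ℝ ∞ lam U) (hlam₀ : ∀ x ∈ U, 0 < lam x)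
  (hy : spaceProj y ∈ U)

include hh hlam hlam₀ hy

theorem christoffel_staticMetric_succ_succ_succ (k i j : Fin 3) :
    christoffel (staticMetric lam h) k.succ i.succ j.succ y =
      christoffel (spatialMetric lam h) k i j (spaceProj y) := by
  have hdiff (i j : Fin 3) := differentiableAt_of_contDiffOn hh.isOpen
    ((hh.spatialMetric hlam hlam₀).smooth i j) hy
  have hpderiv (a i j : Fin 3) : pderiv a.succ (fun z => staticMetric lam h z i.succ j.succ) y =
      pderiv a (fun x => spatialMetric lam h x i j) (spaceProj y) :=
    pderiv_succ_comp_spaceProj (hdiff i j) a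
  rw [christoffel, Fin.sum_univ_succ, staticMetric_inv (hlam₀ _ hy).ne' (hh.isUnit_det hy)]
  simp only [hpderiv, staticMetric_succ_zero, zero_mul, zero_add]
  simp only [staticMetric_succ_succ, christoffel,
    spatialMetric_inv (hlam₀ _ hy).ne' (hh.isUnit_det hy)]

theorem christoffel_staticMetric_zero_succ_zero (i : Fin 3) :
    christoffel (staticMetric lam h) 0 i.succ 0 y =
      1 / 2 * pderiv i (fun x => Real.log (lam x)) (spaceProj y) := by
  have hlam_ne := (hlam₀ _ hy).ne'
  have hdlam := differentiableAt_of_contDiffOn hh.isOpen hlam hy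
  rw [christoffel, Fin.sum_univ_succ, staticMetric_inv hlam_ne (hh.isUnit_det hy)]
  simp only [pderiv_staticMetric_succ_zero, pderiv_succ_staticMetric_zero_zero hdlam hlam_ne]
  simp only [staticMetric_zero_zero, staticMetric_zero_succ, zero_mul, Finset.sum_const_zero]
  field_simp
  ring

theorem christoffel_staticMetric_zero_zero_succ (i : Fin 3) :
    christoffel (staticMetric lam h) 0 0 i.succ y =
      1 / 2 * pderiv i (fun x => Real.log (lam x)) (spaceProj y) := by
  have hlam_ne := (hlam₀ _ hy).ne'
  have hdlam := differentiableAt_of_contDiffOn hh.isOpen hlam hy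
  rw [christoffel, Fin.sum_univ_succ, staticMetric_inv hlam_ne (hh.isUnit_det hy)]
  simp only [pderiv_staticMetric_zero_succ, pderiv_staticMetric_succ_zero,
    pderiv_succ_staticMetric_zero_zero hdlam hlam_ne]
  simp only [staticMetric_zero_zero, staticMetric_zero_succ, zero_mul, Finset.sum_const_zero]
  field_simp
  ring

theorem christoffel_staticMetric_zero_succ_succ (i j : Fin 3) :
    christoffel (staticMetric lam h) 0 i.succ j.succ y = 0 := by
  have hpderiv : pderiv 0 (fun z => staticMetric lam h z i.succ j.succ) y = 0 :=
    pderiv_zero_comp_spaceProj (differentiableAt_of_contDiffOn hh.isOpen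
      ((hh.spatialMetric hlam hlam₀).smooth i j) hy)
  rw [christoffel, Fin.sum_univ_succ, staticMetric_inv (hlam₀ _ hy).ne' (hh.isUnit_det hy)]
  simp only [pderiv_staticMetric_succ_zero, hpderiv, staticMetric_zero_succ, zero_mul, sub_zero,
    add_zero, mul_zero, Finset.sum_const_zero]

theorem christoffel_staticMetric_succ_succ_zero (k i : Fin 3) :
    christoffel (staticMetric lam h) k.succ i.succ 0 y = 0 := by
  have hpderiv (j : Fin 3) : pderiv 0 (fun z => staticMetric lam h z i.succ j.succ) y = 0 :=
    pderiv_zero_comp_spaceProj (differentiableAt_of_contDiffOn hh.isOpen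
      ((hh.spatialMetric hlam hlam₀).smooth i j) hy)
  rw [christoffel, Fin.sum_univ_succ, staticMetric_inv (hlam₀ _ hy).ne' (hh.isUnit_det hy)]
  simp only [pderiv_staticMetric_zero_succ, pderiv_staticMetric_succ_zero, hpderiv]
  simp only [staticMetric_succ_zero, zero_mul, sub_zero, add_zero, mul_zero, Finset.sum_const_zero]

theorem ricci_staticMetric_succ_succ (i j : Fin 3) :
    ricci (staticMetric lam h) y i.succ j.succ =
      ricci (spatialMetric lam h) (spaceProj y) i j -
        1 / 2 * covHessian (spatialMetric lam h) (fun x => Real.log (lam x)) (spaceProj y) i j -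
        1 / 4 * (pderiv i (fun x => Real.log (lam x)) (spaceProj y) *
          pderiv j (fun x => Real.log (lam x)) (spaceProj y)) := by
  have hU := hh.isOpen
  have hk := hh.spatialMetric hlam hlam₀
  have hu : ContDiffOn ℝ ∞ (fun x => Real.log (lam x)) U :=
    hlam.log fun x hx => (hlam₀ x hx).ne'
  have hdu := differentiableAt_of_contDiffOn hU (contDiffOn_pderiv hU hu i) hy
  have hV : IsOpen (spaceProj ⁻¹' U) := hU.preimage spaceProj.continuous
  have pderiv_zero : pderiv 0 (christoffel (staticMetric lam h) 0 i.succ j.succ) y = 0 := by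
    rw [pderiv_congr hV (f' := fun _ => 0)
      (fun z hz => christoffel_staticMetric_zero_succ_succ hh hlam hlam₀ hz i j) hy]
    simp [pderiv]
  have pderiv_log_lam : pderiv j.succ (christoffel (staticMetric lam h) 0 i.succ 0) y =
      1 / 2 * pderiv i (pderiv j fun x => Real.log (lam x)) (spaceProj y) := by
    rw [pderiv_congr hV
        (fun z hz => christoffel_staticMetric_zero_succ_zero hh hlam hlam₀ hz i) hy,
      pderiv_succ_comp_spaceProj (hdu.const_mul (1 / 2)), pderiv_const_mul hdu,
      pderiv_comm ((hu.contDiffAt (hU.mem_nhds hy)).of_le (by norm_cast))]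
  have pderiv_succ (k a i j : Fin 3) :
      pderiv a.succ (christoffel (staticMetric lam h) k.succ i.succ j.succ) y =
        pderiv a (christoffel (spatialMetric lam h) k i j) (spaceProj y) := by
    rw [pderiv_congr hV
        (fun z hz => christoffel_staticMetric_succ_succ_succ hh hlam hlam₀ hz k i j) hy,
      pderiv_succ_comp_spaceProj
        (differentiableAt_of_contDiffOn hU (hk.contDiffOn_christoffel k i j) hy)]
  rw [ricci, ricci, covHessian, Matrix.of_apply]
  simp only [Fin.sum_univ_succ (n := 3), pderiv_zero, pderiv_log_lam, pderiv_succ,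
    christoffel_staticMetric_succ_succ_succ hh hlam hlam₀ hy,
    christoffel_staticMetric_zero_succ_zero hh hlam hlam₀ hy,
    christoffel_staticMetric_zero_zero_succ hh hlam hlam₀ hy,
    christoffel_staticMetric_zero_succ_succ hh hlam hlam₀ hy,
    christoffel_staticMetric_succ_succ_zero hh hlam hlam₀ hy]
  have contracted :
      ∑ l, 1 / 2 * pderiv l (fun x => Real.log (lam x)) (spaceProj y) *
          christoffel (spatialMetric lam h) l i j (spaceProj y) =
        1 / 2 * ∑ l, christoffel (spatialMetric lam h) l i j (spaceProj y) *
          pderiv l (fun x => Real.log (lam x)) (spaceProj y) := by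
    simp only [mul_assoc, ← Finset.mul_sum, mul_comm (pderiv _ _ _)]
  simp only [mul_zero, sub_zero, zero_sub, zero_add, contracted]
  ring

end Static

/-! ### The vacuum equations in terms of the rescaled metric -/

section CovHessian

variable {ι : Type} [Fintype ι] [DecidableEq ι] {U : Set (𝔼 ι)} {g g' : 𝔼 ι → Matrix ι ι ℝ}
  {f s : 𝔼 ι → ℝ} {x : 𝔼 ι}

theorem covHessian_congr (hU : IsOpen U) (h : Set.EqOn g g' U) (hx : x ∈ U) (f : 𝔼 ι → ℝ) :
    covHessian g f x = covHessian g' f x := by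
  ext i j
  simp only [covHessian, Matrix.of_apply, christoffel_congr hU h hx]

theorem covHessian_exp_smul (hg : IsSmoothMetricOn g U) (hs : ContDiffOn ℝ ∞ s U) (hx : x ∈ U)
    (f : 𝔼 ι → ℝ) (i j : ι) :
    covHessian (fun y => Real.exp (2 * s y) • g y) f x i j = covHessian g f x i j -
      (pderiv i f x * pderiv j s x + pderiv j f x * pderiv i s x -
        g x i j * ∑ k, pderiv k f x * metricGradient g s k x) := by
  simp only [covHessian, Matrix.of_apply, christoffel_exp_smul hg hs hx, add_mul,
    Finset.sum_add_distrib, mul_comm (conformalShift _ _ _ _ _ _), sum_mul_conformalShift]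
  ring

theorem covHessian_sub (hU : IsOpen U) (hf : ContDiffOn ℝ ∞ f U) (hs : ContDiffOn ℝ ∞ s U)
    (hx : x ∈ U) (i j : ι) :
    covHessian g (fun y => f y - s y) x i j = covHessian g f x i j - covHessian g s x i j := by
  have hdiff {f : 𝔼 ι → ℝ} (hf : ContDiffOn ℝ ∞ f U) {y : 𝔼 ι} (hy : y ∈ U) :
      DifferentiableAt ℝ f y := differentiableAt_of_contDiffOn hU hf hy
  have hsub (k : ι) : Set.EqOn (pderiv k fun y => f y - s y)
      (fun y => pderiv k f y - pderiv k s y) U :=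
    fun y hy => pderiv_sub (hdiff hf hy) (hdiff hs hy) k
  simp only [covHessian, Matrix.of_apply]
  rw [pderiv_congr hU (hsub j) hx,
    pderiv_sub (hdiff (contDiffOn_pderiv hU hf j) hx) (hdiff (contDiffOn_pderiv hU hs j) hx)]
  simp only [hsub _ hx, mul_sub, Finset.sum_sub_distrib]
  ring

theorem covHessian_const_mul (hU : IsOpen U) (hf : ContDiffOn ℝ ∞ f U) (hx : x ∈ U) (c : ℝ)
    (i j : ι) : covHessian g (fun y => c * f y) x i j = c * covHessian g f x i j := by
  have hmul (k : ι) : Set.EqOn (pderiv k fun y => c * f y) (fun y => c * pderiv k f y) U :=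
    fun y hy => pderiv_const_mul (differentiableAt_of_contDiffOn hU hf hy) c k
  simp only [covHessian, Matrix.of_apply]
  rw [pderiv_congr hU (hmul j) hx,
    pderiv_const_mul (differentiableAt_of_contDiffOn hU (contDiffOn_pderiv hU hf j) hx)]
  simp only [hmul _ hx, mul_left_comm _ c, ← Finset.mul_sum]
  ring

theorem covHessian_log (hU : IsOpen U) (hf : ContDiffOn ℝ ∞ f U) (hf₀ : ∀ y ∈ U, 0 < f y)
    (hx : x ∈ U) (i j : ι) :
    covHessian g (fun y => Real.log (f y)) x i j =
      (f x)⁻¹ * covHessian g f x i j - (f x ^ 2)⁻¹ * (pderiv i f x * pderiv j f x) := by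
  have hdf {y : 𝔼 ι} (hy : y ∈ U) := differentiableAt_of_contDiffOn hU hf hy
  have hlog (k : ι) : Set.EqOn (pderiv k fun y => Real.log (f y))
      (fun y => (f y)⁻¹ * pderiv k f y) U :=
    fun y hy => pderiv_comp (hdf hy) (Real.hasDerivAt_log (hf₀ y hy).ne') k
  have hinv : DifferentiableAt ℝ (fun y => (f y)⁻¹) x := (hdf hx).inv (hf₀ x hx).ne'
  simp only [covHessian, Matrix.of_apply]
  rw [pderiv_congr hU (hlog j) hx, pderiv_mul hinv
    (differentiableAt_of_contDiffOn hU (contDiffOn_pderiv hU hf j) hx),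
    pderiv_comp (hdf hx) (hasDerivAt_inv (hf₀ x hx).ne')]
  simp only [hlog _ hx, mul_left_comm _ (f x)⁻¹, ← Finset.mul_sum]
  ring

theorem pderiv_const_mul_sub_log (hU : IsOpen U) (hs : ContDiffOn ℝ ∞ s U)
    (hf : ContDiffOn ℝ ∞ f U) (hf₀ : ∀ y ∈ U, 0 < f y) (hx : x ∈ U) (c : ℝ) (i : ι) :
    pderiv i (fun y => c * s y - Real.log (f y)) x =
      c * pderiv i s x - (f x)⁻¹ * pderiv i f x := by
  have hdiff {f : 𝔼 ι → ℝ} (hf : ContDiffOn ℝ ∞ f U) : DifferentiableAt ℝ f x :=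
    differentiableAt_of_contDiffOn hU hf hx
  rw [pderiv_sub (hdiff (contDiffOn_const.mul hs)) (hdiff (hf.log fun y hy => (hf₀ y hy).ne')),
    pderiv_const_mul (hdiff hs), pderiv_comp (hdiff hf) (Real.hasDerivAt_log (hf₀ x hx).ne')]

theorem covHessian_const_mul_sub_log (hU : IsOpen U) (hs : ContDiffOn ℝ ∞ s U)
    (hf : ContDiffOn ℝ ∞ f U) (hf₀ : ∀ y ∈ U, 0 < f y) (hx : x ∈ U) (c : ℝ) (i j : ι) :
    covHessian g (fun y => c * s y - Real.log (f y)) x i j = c * covHessian g s x i j -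
      ((f x)⁻¹ * covHessian g f x i j - (f x ^ 2)⁻¹ * (pderiv i f x * pderiv j f x)) := by
  rw [covHessian_sub hU (contDiffOn_const.mul hs) (hf.log fun y hy => (hf₀ y hy).ne') hx,
    covHessian_const_mul hU hs hx, covHessian_log hU hf hf₀ hx]

omit [DecidableEq ι] in
/-- The factor of proportionality extends smoothly to `x₀` because it is the trace of `K`
divided by the dimension. -/
theorem IsSmoothMetricOn.exists_eq_mul_of_punctured [Nonempty ι] (hg : IsSmoothMetricOn g U)
    {K : 𝔼 ι → Matrix ι ι ℝ} (hK : ∀ i j, ContDiffOn ℝ ∞ (fun x => K x i j) U) {x₀ : 𝔼 ι}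
    (hKg : ∀ x ∈ U, x ≠ x₀ → ∃ t : ℝ, ∀ i j, K x i j = t * g x i j) :
    ∃ θ : 𝔼 ι → ℝ, ContDiffOn ℝ ∞ θ U ∧ ∀ x ∈ U, ∀ i j, K x i j = θ x * g x i j := by
  classical
  set θ : 𝔼 ι → ℝ := fun x => (Fintype.card ι : ℝ)⁻¹ * ∑ i, ∑ j, (g x)⁻¹ i j * K x i j
  have hθ : ContDiffOn ℝ ∞ θ U := contDiffOn_const.mul
    (ContDiffOn.sum fun i _ => ContDiffOn.sum fun j _ => (hg.contDiffOn_inv i j).mul (hK i j))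
  have punctured : ∀ x ∈ U, x ≠ x₀ → ∀ i j, K x i j = θ x * g x i j := by
    intro x hx hne i j
    obtain ⟨t, ht⟩ := hKg x hx hne
    have trace (i : ι) : ∑ j, (g x)⁻¹ i j * (t * g x i j) = t := by
      simp only [mul_left_comm _ t, ← Finset.mul_sum, hg.symm hx i, hg.sum_inv_mul hx, if_true,
        mul_one]
    have hθt : θ x = t := by simp [θ, ht, trace]
    rw [ht, hθt]
  refine ⟨θ, hθ, fun x hx i j => ?_⟩
  by_cases hne : x = x₀
  · subst hne
    have hcont {f : 𝔼 ι → ℝ} (hf : ContDiffOn ℝ ∞ f U) : ContinuousAt f x :=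
      hf.continuousOn.continuousAt (hg.isOpen.mem_nhds hx)
    have hnhds := ((hcont (hK i j)).eventuallyEq_nhds_iff_eventuallyEq_nhdsNE
      (hcont (hθ.mul (hg.smooth i j)))).mp (by
        filter_upwards [self_mem_nhdsWithin, nhdsWithin_le_nhds (hg.isOpen.mem_nhds hx)]
          with y hyx hy using punctured y hy hyx i j)
    exact hnhds.eq_of_nhds
  · exact punctured x hx hne i j

end CovHessian

section RescaledDifferential

theorem contDiffOn_sourceCoefficient {E : Type*} [NormedAddCommGroup E] [NormedSpace ℝ E]
    {U : Set E} {φ Ω : E → ℝ} (hΩ : ContDiffOn ℝ ∞ Ω U) (hφ : ContDiffOn ℝ ∞ φ U)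
    (hΩ₀ : ∀ x ∈ U, 0 ≤ Ω x) : ContDiffOn ℝ ∞ (fun x => 8 * (4 + Ω x * φ x ^ 2)⁻¹) U :=
  contDiffOn_const.mul ((contDiffOn_const.add (hΩ.mul (hφ.pow 2))).inv fun x hx => by
    have := hΩ₀ x hx
    positivity)

variable {ι : Type} [Fintype ι] [DecidableEq ι] {U : Set (𝔼 ι)} {φ Ω : 𝔼 ι → ℝ} {x : 𝔼 ι}

/-- The components of `√Ω d(√Ω φ) = Ω dφ + φ dΩ / 2`. The right-hand side is smooth also where `Ω`
vanishes. -/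
def rescaledDifferential (Ω φ : 𝔼 ι → ℝ) (i : ι) (x : 𝔼 ι) : ℝ :=
  Ω x * pderiv i φ x + 1 / 2 * φ x * pderiv i Ω x

theorem rescaledDifferential_eq_sqrt_mul (hΩ : DifferentiableAt ℝ Ω x) (hΩ₀ : 0 < Ω x)
    (hφ : DifferentiableAt ℝ φ x) (i : ι) :
    rescaledDifferential Ω φ i x = √(Ω x) * pderiv i (fun y => √(Ω y) * φ y) x := by
  rw [pderiv_mul (hΩ.sqrt hΩ₀.ne') hφ, pderiv_comp hΩ (Real.hasDerivAt_sqrt hΩ₀.ne'),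
    rescaledDifferential]
  have hsqrt : √(Ω x) ≠ 0 := (Real.sqrt_pos.mpr hΩ₀).ne'
  field_simp
  rw [Real.sq_sqrt hΩ₀.le]
  ring

theorem contDiffOn_rescaledDifferential (hU : IsOpen U) (hΩ : ContDiffOn ℝ ∞ Ω U)
    (hφ : ContDiffOn ℝ ∞ φ U) (i : ι) : ContDiffOn ℝ ∞ (rescaledDifferential Ω φ i) U :=
  (hΩ.mul (contDiffOn_pderiv hU hφ i)).add
    ((contDiffOn_const.mul hφ).mul (contDiffOn_pderiv hU hΩ i))

/-- The tensor `(8 / (4 + Ω φ²)) W_i W_j`, where `W` is the rescaled differential of `φ`. If `φ` is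
the rescaled Geroch potential, then it is the source term `(Ω / 2) ∂_i log λ ∂_j log λ` of the
vacuum equations. -/
def rescaledSource (Ω φ : 𝔼 ι → ℝ) (x : 𝔼 ι) : Matrix ι ι ℝ :=
  Matrix.of fun i j => 8 * (4 + Ω x * φ x ^ 2)⁻¹ *
    (rescaledDifferential Ω φ i x * rescaledDifferential Ω φ j x)

theorem contDiffOn_rescaledSource (hU : IsOpen U) (hΩ : ContDiffOn ℝ ∞ Ω U)
    (hφ : ContDiffOn ℝ ∞ φ U) (hΩ₀ : ∀ x ∈ U, 0 ≤ Ω x) (i j : ι) :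
    ContDiffOn ℝ ∞ (fun x => rescaledSource Ω φ x i j) U :=
  (contDiffOn_sourceCoefficient hΩ hφ hΩ₀).mul
    ((contDiffOn_rescaledDifferential hU hΩ hφ i).mul (contDiffOn_rescaledDifferential hU hΩ hφ j))

theorem rescaledSource_eq_of_sinh {u : 𝔼 ι → ℝ} (hU : IsOpen U) (hΩ : DifferentiableAt ℝ Ω x)
    (hφ : DifferentiableAt ℝ φ x) (hu : DifferentiableAt ℝ u x)
    (hΩ₀ : 0 < Ω x) (hφu : Set.EqOn (fun y => √(Ω y) * φ y) (fun y => -2 * Real.sinh (u y / 4)) U)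
    (hx : x ∈ U) (i j : ι) :
    rescaledSource Ω φ x i j = Ω x / 2 * (pderiv i u x * pderiv j u x) := by
  have hsq : √(Ω x) ^ 2 = Ω x := Real.sq_sqrt hΩ₀.le
  have hderiv : HasDerivAt (fun r => -2 * Real.sinh (r / 4)) (-(1 / 2) * Real.cosh (u x / 4))
      (u x) :=
    ((((hasDerivAt_id (u x)).div_const 4).sinh).const_mul (-2)).congr_deriv (by simp; ring)
  have hW (k : ι) : rescaledDifferential Ω φ k x =
      -(1 / 2) * √(Ω x) * Real.cosh (u x / 4) * pderiv k u x := by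
    rw [rescaledDifferential_eq_sqrt_mul hΩ hΩ₀ hφ, pderiv_congr hU hφu hx,
      pderiv_comp hu hderiv]
    ring
  have hcosh : 4 + Ω x * φ x ^ 2 = 4 * Real.cosh (u x / 4) ^ 2 := by
    have h : √(Ω x) * φ x = -2 * Real.sinh (u x / 4) := hφu hx
    rw [← hsq, ← mul_pow, h, Real.cosh_sq]
    ring
  have hcosh_ne : Real.cosh (u x / 4) ≠ 0 := (Real.cosh_pos _).ne'
  rw [rescaledSource, Matrix.of_apply, hW, hW, hcosh]
  field_simp
  rw [hsq]
  ring

theorem quadForm_rescaledSource (v : 𝔼 ι) :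
    quadForm (rescaledSource Ω φ x) v = 8 * (4 + Ω x * φ x ^ 2)⁻¹ *
      (Ω x * diffForm φ (x, v) + 1 / 2 * φ x * diffForm Ω (x, v)) ^ 2 := by
  have hW : Ω x * diffForm φ (x, v) + 1 / 2 * φ x * diffForm Ω (x, v) =
      ∑ i, rescaledDifferential Ω φ i x * v i := by
    simp only [diffForm, fderiv_eq_sum_pderiv, rescaledDifferential, Finset.mul_sum,
      ← Finset.sum_add_distrib]
    exact Finset.sum_congr rfl fun i _ => by ring
  rw [hW, quadForm, sq (∑ i, rescaledDifferential Ω φ i x * v i), Finset.sum_mul_sum,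
    Finset.mul_sum]
  refine Finset.sum_congr rfl fun i _ => ?_
  rw [Finset.mul_sum]
  exact Finset.sum_congr rfl fun j _ => by rw [rescaledSource, Matrix.of_apply]; ring

end RescaledDifferential

section Vacuum

variable {U : Set (𝔼 (Fin 3))} {g : 𝔼 (Fin 3) → Matrix (Fin 3) (Fin 3) ℝ}
  {lam Ω φ : 𝔼 (Fin 3) → ℝ} {x x₀ : 𝔼 (Fin 3)}

theorem spatialMetric_inv_sq_smul (hlam : 0 < lam x) (hΩ : 0 < Ω x) :
    spatialMetric lam (fun y => (Ω y ^ 2)⁻¹ • g y) x =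
      Real.exp (2 * (-(1 / 2) * Real.log (lam x) - Real.log (Ω x))) • g x := by
  have hexp : 2 * (-(1 / 2) * Real.log (lam x) - Real.log (Ω x)) =
      Real.log ((lam x)⁻¹ * (Ω x ^ 2)⁻¹) := by
    rw [Real.log_mul (by positivity) (by positivity), Real.log_inv, Real.log_inv, Real.log_pow]
    push_cast
    ring
  rw [spatialMetric, smul_smul, hexp, Real.exp_log (by positivity)]

theorem IsSmoothMetricOn.inv_sq_smul (hg : IsSmoothMetricOn g U) (hΩ : ContDiffOn ℝ ∞ Ω U)
    (hΩ₀ : ∀ x ∈ U, 0 < Ω x) : IsSmoothMetricOn (fun x => (Ω x ^ 2)⁻¹ • g x) U := by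
  refine (hg.exp_smul (s := fun x => -Real.log (Ω x))
    (hΩ.log fun x hx => (hΩ₀ x hx).ne').neg).congr fun x hx => ?_
  have hexp : Real.exp (2 * -Real.log (Ω x)) = (Ω x ^ 2)⁻¹ := by
    rw [mul_neg, Real.exp_neg, mul_comm, Real.exp_mul, Real.exp_log (hΩ₀ x hx)]
    norm_cast
  simp only [hexp]

theorem exists_covHessian_eq_of_ricci_staticMetric_eq_zero (hg : IsSmoothMetricOn g U)
    (hlam : ContDiffOn ℝ ∞ lam U) (hlam₀ : ∀ x ∈ U, 0 < lam x) (hΩ : ContDiffOn ℝ ∞ Ω U)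
    (hΩ₀ : ∀ x ∈ U, 0 < Ω x)
    (hvac : ∀ y, spaceProj y ∈ U → ∀ i j : Fin 3,
      ricci (staticMetric lam fun x => (Ω x ^ 2)⁻¹ • g x) y i.succ j.succ = 0)
    (hx : x ∈ U) :
    ∃ t : ℝ, ∀ i j, Ω x * ricci g x i j + covHessian g Ω x i j -
      Ω x / 2 * (pderiv i (fun y => Real.log (lam y)) x * pderiv j (fun y => Real.log (lam y)) x) =
        t * g x i j := by
  have hU := hg.isOpen
  obtain ⟨y, rfl⟩ := spaceProj_surjective x
  set x := spaceProj y
  set u : 𝔼 (Fin 3) → ℝ := fun y => Real.log (lam y)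
  have hu : ContDiffOn ℝ ∞ u U := hlam.log fun y hy => (hlam₀ y hy).ne'
  set s : 𝔼 (Fin 3) → ℝ := fun y => -(1 / 2) * u y - Real.log (Ω y)
  have hs : ContDiffOn ℝ ∞ s U :=
    (contDiffOn_const.mul hu).sub (hΩ.log fun y hy => (hΩ₀ y hy).ne')
  have hconf : Set.EqOn (spatialMetric lam fun y => (Ω y ^ 2)⁻¹ • g y)
      (fun y => Real.exp (2 * s y) • g y) U :=
    fun y hy => spatialMetric_inv_sq_smul (hlam₀ y hy) (hΩ₀ y hy)
  refine ⟨Ω x * (laplacian g s x + ∑ k, pderiv k s x * metricGradient g s k x +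
    1 / 2 * ∑ k, pderiv k u x * metricGradient g s k x), fun i j => ?_⟩
  have vacuum := hvac y hx i j
  rw [ricci_staticMetric_succ_succ (hg.inv_sq_smul hΩ hΩ₀) hlam hlam₀ hx, ricci_congr hU hconf hx,
    covHessian_congr hU hconf hx, ricci_exp_smul hg hs hx, covHessian_exp_smul hg hs hx,
    covHessian_const_mul_sub_log hU hu hΩ hΩ₀ hx, pderiv_const_mul_sub_log hU hu hΩ hΩ₀ hx,
    pderiv_const_mul_sub_log hU hu hΩ hΩ₀ hx, Fintype.card_fin] at vacuum
  have hΩ_ne : Ω x * (Ω x)⁻¹ = 1 := mul_inv_cancel₀ (hΩ₀ x hx).ne'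
  push_cast at vacuum
  linear_combination Ω x * vacuum - covHessian g Ω x i j * hΩ_ne

variable (hg : IsSmoothMetricOn g U) (hlam : ContDiffOn ℝ ∞ lam (U \ {x₀}))
  (hlam₀ : ∀ x ∈ U \ {x₀}, 0 < lam x) (hΩ : ContDiffOn ℝ ∞ Ω U) (hΩ₀ : ∀ x ∈ U, 0 ≤ Ω x)
  (hΩ_pos : ∀ x ∈ U \ {x₀}, 0 < Ω x) (hφ : ContDiffOn ℝ ∞ φ U)
  (hφ_sinh : ∀ x ∈ U \ {x₀}, √(Ω x) * φ x = -2 * Real.sinh (Real.log (lam x) / 4))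
  (hvac : ∀ y, spaceProj y ∈ U \ {x₀} → ∀ i j : Fin 3,
    ricci (staticMetric lam fun x => (Ω x ^ 2)⁻¹ • g x) y i.succ j.succ = 0)

include hg hlam hlam₀ hΩ hΩ₀ hΩ_pos hφ hφ_sinh hvac

theorem exists_covHessian_eq_rescaledSource :
    ∃ θ : 𝔼 (Fin 3) → ℝ, ContDiffOn ℝ ∞ θ U ∧ ∀ x ∈ U, ∀ i j,
      Ω x * ricci g x i j + covHessian g Ω x i j - rescaledSource Ω φ x i j = θ x * g x i j := by
  have hU := hg.isOpen
  have hV : IsOpen (U \ {x₀}) := hU.sdiff isClosed_singleton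
  have hVU : U \ {x₀} ⊆ U := Set.sdiff_subset
  refine hg.exists_eq_mul_of_punctured (x₀ := x₀)
    (K := fun x => Matrix.of fun i j =>
      Ω x * ricci g x i j + covHessian g Ω x i j - rescaledSource Ω φ x i j)
    (fun i j => ((hΩ.mul (hg.contDiffOn_ricci i j)).add (contDiffOn_covHessian hg hΩ i j)).sub
      (contDiffOn_rescaledSource hU hΩ hφ hΩ₀ i j)) fun x hx hne => ?_
  have hxV : x ∈ U \ {x₀} := ⟨hx, hne⟩
  obtain ⟨t, ht⟩ := exists_covHessian_eq_of_ricci_staticMetric_eq_zero (hg.mono hV hVU) hlam hlam₀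
    (hΩ.mono hVU) hΩ_pos hvac hxV
  have hdiff {f : 𝔼 (Fin 3) → ℝ} (hf : ContDiffOn ℝ ∞ f U) : DifferentiableAt ℝ f x :=
    differentiableAt_of_contDiffOn hU hf hx
  have hdu : DifferentiableAt ℝ (fun y => Real.log (lam y)) x :=
    (differentiableAt_of_contDiffOn hV hlam hxV).log (hlam₀ x hxV).ne'
  refine ⟨t, fun i j => ?_⟩
  rw [Matrix.of_apply, ← ht,
    rescaledSource_eq_of_sinh hV (hdiff hΩ) (hdiff hφ) hdu (hΩ_pos x hxV) hφ_sinh hxV]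

/-- The terms of the vacuum equations are, in this order, multiples of `Ω`, of `dΩ` and of the
metric. -/
theorem memSmoothIdeal_quadForm_covHessian :
    MemSmoothIdeal (Prod.fst ⁻¹' U) (jetGenerators g Ω) fun p =>
      quadForm (covHessian g Ω p.1) p.2 := by
  have hU := hg.isOpen
  obtain ⟨θ, hθ, hess⟩ := exists_covHessian_eq_rescaledSource hg hlam hlam₀ hΩ hΩ₀ hΩ_pos hφ
    hφ_sinh hvac
  set w : 𝔼 (Fin 3) × 𝔼 (Fin 3) → ℝ := fun p =>
    Ω p.1 * diffForm φ p + 1 / 2 * φ p.1 * diffForm Ω p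
  have hw : ContDiffOn ℝ ∞ w (Prod.fst ⁻¹' U) :=
    ((contDiffOn_comp_fst hΩ).mul (contDiffOn_diffForm hU hφ)).add
      ((contDiffOn_const.mul (contDiffOn_comp_fst hφ)).mul (contDiffOn_diffForm hU hΩ))
  have hcw := (contDiffOn_comp_fst (contDiffOn_sourceCoefficient hΩ hφ hΩ₀)).mul hw
  refine ⟨![fun p => 8 * (4 + Ω p.1 * φ p.1 ^ 2)⁻¹ * w p * diffForm φ p -
      quadForm (Matrix.of (ricci g p.1)) p.2,
    fun p => 8 * (4 + Ω p.1 * φ p.1 ^ 2)⁻¹ * w p * (1 / 2 * φ p.1), fun p => θ p.1],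
    fun k => ?_, fun p hp => ?_⟩
  · fin_cases k
    exacts [(hcw.mul (contDiffOn_diffForm hU hφ)).sub (contDiffOn_quadForm hg.contDiffOn_ricci),
      hcw.mul (contDiffOn_const.mul (contDiffOn_comp_fst hφ)), contDiffOn_comp_fst hθ]
  · have expand : quadForm (covHessian g Ω p.1) p.2 = θ p.1 * quadForm (g p.1) p.2 -
        Ω p.1 * quadForm (Matrix.of (ricci g p.1)) p.2 + quadForm (rescaledSource Ω φ p.1) p.2 := by
      simp only [quadForm, Finset.mul_sum, ← Finset.sum_sub_distrib, ← Finset.sum_add_distrib]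
      refine Finset.sum_congr rfl fun i _ => Finset.sum_congr rfl fun j _ => ?_
      rw [Matrix.of_apply]
      linear_combination (p.2 i * p.2 j) * hess p.1 hp i j
    simp only [expand, quadForm_rescaledSource, Fin.sum_univ_three, jetGenerators, Matrix.cons_val]
    simp only [w]
    ring

end Vacuum

/-! ### The Hansen and the Geroch potential as functions of each other -/

section Potentials

/-- The factor `F` for which `φ_H = φ_G F(φ_G²)`. Both it and `gerochRatio` are regular at `0`, and
this is why `φ_H` and `φ_G` can be rescaled simultaneously. -/
def hansenRatio (w : ℝ) : ℝ := √(1 + w / 4) * (1 + w / 2)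

/-- The factor `F` for which `φ_G = φ_H F(φ_H²)`. -/
def gerochRatio (w : ℝ) : ℝ :=
  (√((1 + √(1 + 4 * w)) / 2) * √((1 + √((1 + √(1 + 4 * w)) / 2)) / 2))⁻¹

variable {l : ℝ}

theorem one_sub_sq_div_eq_sinh (hl : 0 < l) :
    (1 - l ^ 2) / (4 * l) = -(1 / 2) * Real.sinh (Real.log l) := by
  rw [Real.sinh_log hl]
  field_simp
  ring

theorem rpow_mul_one_sub_sqrt_eq_sinh (hl : 0 < l) :
    l ^ (-(1 / 4) : ℝ) * (1 - √l) = -2 * Real.sinh (Real.log l / 4) := by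
  have hsqrt : √l = Real.exp (Real.log l / 2) := by rw [Real.exp_half, Real.exp_log hl]
  rw [Real.rpow_def_of_pos hl, hsqrt, Real.sinh_eq, mul_sub, mul_one, ← Real.exp_add]
  ring_nf

theorem sqrt_one_add_cosh_two_mul_div_two (a : ℝ) :
    √((1 + Real.cosh (2 * a)) / 2) = Real.cosh a := by
  rw [← Real.sqrt_sq (Real.cosh_pos a).le, Real.cosh_two_mul, Real.cosh_sq]
  ring_nf

theorem sinh_four_mul_eq_mul_hansenRatio (a : ℝ) :
    -(1 / 2) * Real.sinh (4 * a) = -2 * Real.sinh a * hansenRatio ((-2 * Real.sinh a) ^ 2) := by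
  have hcosh : √(1 + (-2 * Real.sinh a) ^ 2 / 4) = Real.cosh a := by
    rw [← Real.sqrt_sq (Real.cosh_pos a).le, Real.cosh_sq]
    ring_nf
  rw [hansenRatio, hcosh, show 4 * a = 2 * (2 * a) by ring, Real.sinh_two_mul, Real.sinh_two_mul,
    Real.cosh_two_mul, Real.cosh_sq]
  ring

theorem sinh_eq_mul_gerochRatio (a : ℝ) :
    -2 * Real.sinh a =
      -(1 / 2) * Real.sinh (4 * a) * gerochRatio ((-(1 / 2) * Real.sinh (4 * a)) ^ 2) := by
  have hcosh : √(1 + 4 * (-(1 / 2) * Real.sinh (4 * a)) ^ 2) = Real.cosh (2 * (2 * a)) := by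
    rw [← Real.sqrt_sq (Real.cosh_pos _).le, Real.cosh_sq]
    ring_nf
  have hcosh_ne (b : ℝ) : Real.cosh b ≠ 0 := (Real.cosh_pos b).ne'
  rw [gerochRatio, hcosh, sqrt_one_add_cosh_two_mul_div_two, sqrt_one_add_cosh_two_mul_div_two,
    show 4 * a = 2 * (2 * a) by ring, Real.sinh_two_mul, Real.sinh_two_mul]
  have := hcosh_ne a
  have := hcosh_ne (2 * a)
  field_simp

theorem contDiffAt_hansenRatio {w : ℝ} (hw : 0 ≤ w) : ContDiffAt ℝ ∞ hansenRatio w :=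
  ((contDiffAt_const.add (contDiffAt_id.div_const 4)).sqrt
    (by simp only [id]; positivity)).mul (contDiffAt_const.add (contDiffAt_id.div_const 2))

theorem contDiffAt_gerochRatio {w : ℝ} (hw : 0 ≤ w) : ContDiffAt ℝ ∞ gerochRatio w := by
  have hroot : ContDiffAt ℝ ∞ (fun w : ℝ => √((1 + √(1 + 4 * w)) / 2)) w :=
    ((contDiffAt_const.add ((contDiffAt_const.add (contDiffAt_const.mul contDiffAt_id)).sqrt
      (by simp only [id]; positivity))).div_const 2).sqrt (by positivity)
  exact (hroot.mul (((contDiffAt_const.add hroot).div_const 2).sqrt (by positivity))).inv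
    (by positivity)

theorem exists_hansenRatio_eq_one_add_mul :
    ∃ q : ℝ → ℝ, (∀ w, 0 ≤ w → ContDiffAt ℝ ∞ q w) ∧
      ∀ w, 0 ≤ w → hansenRatio w = 1 + w * q w := by
  refine ⟨fun w => (1 + w / 2) / (4 * (√(1 + w / 4) + 1)) + 1 / 2, fun w hw => ?_, fun w hw => ?_⟩
  · exact ((contDiffAt_const.add (contDiffAt_id.div_const 2)).div (contDiffAt_const.mul
      (((contDiffAt_const.add (contDiffAt_id.div_const 4)).sqrt
        (by simp only [id]; positivity)).add contDiffAt_const)) (by positivity)).add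
      contDiffAt_const
  · have hsq : √(1 + w / 4) ^ 2 = 1 + w / 4 := Real.sq_sqrt (by positivity)
    have hroot : √(1 + w / 4) + 1 ≠ 0 := by positivity
    simp only [hansenRatio]
    set r := √(1 + w / 4)
    field_simp
    linear_combination (8 + 4 * w) * hsq

end Potentials

section Manifold

/-! ### The spacetime in a chart -/

theorem posDef_pullback {ι : Type} {E : Type*} [Fintype ι] [DecidableEq ι] [AddCommGroup E]
    [Module ℝ E] [TopologicalSpace E] {B : E →L[ℝ] E →L[ℝ] ℝ} (hB : ∀ v w, B v w = B w v)
    (hB_pos : ∀ v, v ≠ 0 → 0 < B v v) {A : 𝔼 ι →L[ℝ] E} (hA : Function.Injective A) :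
    (Matrix.of fun i j =>
      B (A (EuclideanSpace.single i 1)) (A (EuclideanSpace.single j 1))).PosDef := by
  refine Matrix.PosDef.of_dotProduct_mulVec_pos (Matrix.ext fun i j => hB _ _) fun v hv => ?_
  have hAv : A (WithLp.toLp 2 v) ≠ 0 := (map_ne_zero_iff A hA).mpr (by simpa using hv)
  have hsum : A (WithLp.toLp 2 v) = ∑ i, v i • A (EuclideanSpace.single i 1) := by
    conv_lhs => rw [← sum_smul_single (WithLp.toLp 2 v)]
    simp only [map_sum, map_smul]
  refine (hB_pos _ hAv).trans_eq ?_
  simp only [hsum, map_sum, map_smul, sum_apply, smul_apply, smul_eq_mul, dotProduct,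
    Matrix.mulVec, Matrix.of_apply, star_trivial, Finset.mul_sum]
  rw [Finset.sum_comm]
  exact Finset.sum_congr rfl fun i _ => Finset.sum_congr rfl fun j _ => by ring

theorem neBot_nhdsNE_of_chartedSpace (H : Type*) {M : Type*} [TopologicalSpace H]
    [∀ x : H, (nhdsWithin x {x}ᶜ).NeBot] [TopologicalSpace M] [ChartedSpace H M] (p : M) :
    (nhdsWithin p {p}ᶜ).NeBot := by
  rw [Filter.neBot_iff, Ne, ← isOpen_singleton_iff_punctured_nhds]
  intro hp
  have himage := (chartAt H p).isOpen_image_of_subset_source hp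
    (Set.singleton_subset_iff.mpr (mem_chart_source H p))
  rw [Set.image_singleton] at himage
  exact not_isOpen_singleton _ himage

variable {Vt : Type*} [TopologicalSpace Vt] [ChartedSpace (𝔼 (Fin 3)) Vt]
  {e : OpenPartialHomeomorph Vt (𝔼 (Fin 3))}

theorem contDiffOn_comp_symm (he : e ∈ IsManifold.maximalAtlas (𝓡 3) ∞ Vt) {f : Vt → ℝ}
    (hf : ContMDiff (𝓡 3) 𝓘(ℝ, ℝ) ∞ f) : ContDiffOn ℝ ∞ (f ∘ e.symm) e.target :=
  contMDiffOn_iff_contDiffOn.mp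
    (hf.comp_contMDiffOn (contMDiffOn_symm_of_mem_maximalAtlas he))

variable [IsManifold (𝓡 3) ∞ Vt]

theorem contMDiffOn_coordinateVector (he : e ∈ IsManifold.maximalAtlas (𝓡 3) ∞ Vt) (i : Fin 3) :
    ContMDiffOn (𝓡 3) (𝓡 3).tangent ∞ (fun x => (⟨e.symm x, mfderiv (𝓡 3) (𝓡 3) e.symm x
      (EuclideanSpace.single i (1 : ℝ) : 𝔼 (Fin 3))⟩ : TangentBundle (𝓡 3) Vt)) e.target := by
  have tangentMap_smooth := (contMDiffOn_symm_of_mem_maximalAtlas he).contMDiffOn_tangentMapWithin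
    (m := ∞) (by simp) e.open_target.uniqueMDiffOn
  have const_smooth : ContMDiffOn (𝓡 3) (𝓡 3).tangent ∞ (fun x : 𝔼 (Fin 3) =>
      (⟨x, (EuclideanSpace.single i (1 : ℝ) : 𝔼 (Fin 3))⟩ : TangentBundle (𝓡 3) (𝔼 (Fin 3))))
      e.target := fun x _ =>
    (contMDiffAt_vectorSpace_iff_contDiffAt.mpr contDiffAt_const).contMDiffWithinAt
  refine (tangentMap_smooth.comp const_smooth fun x hx => hx).congr fun x hx => ?_
  simp only [Function.comp_apply, tangentMapWithin, mfderivWithin_of_isOpen e.open_target hx]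

theorem mfderiv_symm_injective (he : e ∈ IsManifold.maximalAtlas (𝓡 3) ∞ Vt) {x : 𝔼 (Fin 3)}
    (hx : x ∈ e.target) : Function.Injective (mfderiv (𝓡 3) (𝓡 3) e.symm x) := by
  have : IsManifold (𝓡 3) 1 Vt := IsManifold.of_le (n := ∞) (by simp)
  have hdiff : e.MDifferentiable (𝓡 3) (𝓡 3) :=
    ⟨(contMDiffOn_of_mem_maximalAtlas he).mdifferentiableOn (by simp),
      (contMDiffOn_symm_of_mem_maximalAtlas he).mdifferentiableOn (by simp)⟩
  exact hdiff.symm.mfderiv_injective hx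

namespace StaticAF

variable {S : StaticAF Vt}

theorem Ω_nonneg (p : Vt) : 0 ≤ S.Ω p := by
  by_cases hp : p = S.Λ
  exacts [hp ▸ S.Ω_zero.ge, (S.Ω_pos p hp).le]

theorem symm_ne_Λ {x : 𝔼 (Fin 3)} (hx : x ∈ e.target \ {e S.Λ}) : e.symm x ≠ S.Λ := fun h =>
  hx.2 (by rw [Set.mem_singleton_iff, ← h, e.right_inv hx.1])

theorem contDiffOn_lam (he : e ∈ IsManifold.maximalAtlas (𝓡 3) ∞ Vt) :
    ContDiffOn ℝ ∞ (S.lam ∘ e.symm) (e.target \ {e S.Λ}) :=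
  contMDiffOn_iff_contDiffOn.mp (S.lam_smooth.comp
    ((contMDiffOn_symm_of_mem_maximalAtlas he).mono Set.sdiff_subset) fun _ hx => symm_ne_Λ hx)

theorem contDiffOn_htChart (he : e ∈ IsManifold.maximalAtlas (𝓡 3) ∞ Vt) (i j : Fin 3) :
    ContDiffOn ℝ ∞ (fun x => S.htChart e x i j) e.target := by
  rw [← contMDiffOn_iff_contDiffOn]
  intro x hx
  have section_smooth : ContMDiffWithinAt (𝓡 3) ((𝓡 3).prod 𝓘(ℝ)) ∞ (fun x =>
      Bundle.TotalSpace.mk' ℝ (E := Bundle.Trivial Vt ℝ) (e.symm x) (S.ht.inner (e.symm x)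
        (mfderiv (𝓡 3) (𝓡 3) e.symm x (EuclideanSpace.single i (1 : ℝ) : 𝔼 (Fin 3)))
        (mfderiv (𝓡 3) (𝓡 3) e.symm x
          (EuclideanSpace.single j (1 : ℝ) : 𝔼 (Fin 3))))) e.target x := by
    apply ContMDiffWithinAt.clm_bundle_apply₂ (F₁ := 𝔼 (Fin 3)) (F₂ := 𝔼 (Fin 3))
    · exact ContMDiffAt.comp_contMDiffWithinAt x S.ht.contMDiff.contMDiffAt
        (contMDiffOn_symm_of_mem_maximalAtlas he x hx)
    · exact contMDiffOn_coordinateVector he i x hx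
    · exact contMDiffOn_coordinateVector he j x hx
  simp only [Bundle.contMDiffWithinAt_totalSpace] at section_smooth
  exact section_smooth.2

theorem isSmoothMetricOn_htChart (he : e ∈ IsManifold.maximalAtlas (𝓡 3) ∞ Vt) :
    IsSmoothMetricOn (S.htChart e) e.target where
  isOpen := e.open_target
  smooth := contDiffOn_htChart he
  posDef x hx := posDef_pullback (S.ht.symm (e.symm x)) (S.ht.pos (e.symm x))
    (A := mfderiv (𝓡 3) (𝓡 3) e.symm x) (mfderiv_symm_injective he hx)

theorem chartComponents_h (e : OpenPartialHomeomorph Vt (𝔼 (Fin 3))) :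
    chartComponents S.h e = fun x => ((S.Ω ∘ e.symm) x ^ 2)⁻¹ • S.htChart e x := rfl

/-! ### Comparison of the rescaled potentials -/

variable {φ φ' φt φt' : Vt → ℝ}

theorem IsRescaled.sqrt_mul (hφ : S.IsRescaled φ φt) {p : Vt} (hp : p ≠ S.Λ) :
    √(S.Ω p) * φt p = φ p := by
  rw [hφ.2 p hp, mul_div_cancel₀ _ (Real.sqrt_pos.mpr (S.Ω_pos p hp)).ne']

theorem contMDiff_comp_Ω_mul_sq (hφt : ContMDiff (𝓡 3) 𝓘(ℝ, ℝ) ∞ φt) {F : ℝ → ℝ}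
    (hF : ∀ w, 0 ≤ w → ContDiffAt ℝ ∞ F w) :
    ContMDiff (𝓡 3) 𝓘(ℝ, ℝ) ∞ fun p => F (S.Ω p * φt p ^ 2) := fun p =>
  (hF _ (mul_nonneg (Ω_nonneg p) (sq_nonneg _))).contMDiffAt.comp p
    (S.Ω_smooth.mul (hφt.pow 2)).contMDiffAt

theorem IsRescaled.mul_comp_sq (hφ : S.IsRescaled φ φt) {F : ℝ → ℝ}
    (hF : ∀ w, 0 ≤ w → ContDiffAt ℝ ∞ F w) (hφ' : ∀ p, p ≠ S.Λ → φ' p = φ p * F (φ p ^ 2)) :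
    S.IsRescaled φ' fun p => φt p * F (S.Ω p * φt p ^ 2) := by
  refine ⟨hφ.1.mul (contMDiff_comp_Ω_mul_sq hφ.1 hF), fun p hp => ?_⟩
  have hsq : S.Ω p * φt p ^ 2 = φ p ^ 2 := by
    rw [← hφ.sqrt_mul hp, mul_pow, Real.sq_sqrt (Ω_nonneg p)]
  simp only [hsq]
  rw [hφ' p hp, hφ.2 p hp]
  ring

theorem IsRescaled.unique (hφ : S.IsRescaled φ φt) (hφ' : S.IsRescaled φ φt') : φt = φt' := by
  have := neBot_nhdsNE_of_chartedSpace (𝔼 (Fin 3)) S.Λ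
  exact hφ.1.continuous.ext_on (dense_compl_singleton S.Λ) hφ'.1.continuous
    fun p hp => (hφ.2 p hp).trans (hφ'.2 p hp).symm

theorem hansen_eq_sinh {p : Vt} (hp : p ≠ S.Λ) :
    S.hansen p = -(1 / 2) * Real.sinh (4 * (Real.log (S.lam p) / 4)) := by
  rw [hansen, one_sub_sq_div_eq_sinh (S.lam_pos p hp), mul_div_cancel₀ _ four_ne_zero]

theorem geroch_eq_sinh {p : Vt} (hp : p ≠ S.Λ) :
    S.geroch p = -2 * Real.sinh (Real.log (S.lam p) / 4) :=
  rpow_mul_one_sub_sqrt_eq_sinh (S.lam_pos p hp)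

theorem IsRescaled.hansen_of_geroch (hφ : S.IsRescaled S.geroch φ) :
    S.IsRescaled S.hansen fun p => φ p * hansenRatio (S.Ω p * φ p ^ 2) :=
  hφ.mul_comp_sq (fun _ => contDiffAt_hansenRatio) fun p hp => by
    rw [hansen_eq_sinh hp, geroch_eq_sinh hp, sinh_four_mul_eq_mul_hansenRatio]

theorem IsRescaled.geroch_of_hansen (hφ : S.IsRescaled S.hansen φ) :
    S.IsRescaled S.geroch fun p => φ p * gerochRatio (S.Ω p * φ p ^ 2) :=
  hφ.mul_comp_sq (fun _ => contDiffAt_gerochRatio) fun p hp => by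
    rw [hansen_eq_sinh hp, geroch_eq_sinh hp, ← sinh_eq_mul_gerochRatio]

theorem exists_sub_eq_mul_Ω (hφ : S.IsRescaled S.hansen φ) (hφ' : S.IsRescaled S.geroch φ') :
    ∃ f : Vt → ℝ, ContMDiff (𝓡 3) 𝓘(ℝ, ℝ) ∞ f ∧ ∀ p, φ p - φ' p = f p * S.Ω p := by
  obtain ⟨q, hq, hansenRatio_eq⟩ := exists_hansenRatio_eq_one_add_mul
  refine ⟨fun p => φ' p ^ 3 * q (S.Ω p * φ' p ^ 2),
    (hφ'.1.pow 3).mul (contMDiff_comp_Ω_mul_sq hφ'.1 hq), fun p => ?_⟩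
  simp only [hφ.unique hφ'.hansen_of_geroch]
  rw [hansenRatio_eq _ (mul_nonneg (Ω_nonneg p) (sq_nonneg _))]
  ring

theorem memSmoothIdeal_quadForm_covHessian_htChart (hvac : S.IsVacuum)
    (hφ : S.IsRescaled S.geroch φ) (he : e ∈ IsManifold.maximalAtlas (𝓡 3) ∞ Vt) :
    MemSmoothIdeal (Prod.fst ⁻¹' e.target) (jetGenerators (S.htChart e) (S.Ω ∘ e.symm))
      fun p => quadForm (covHessian (S.htChart e) (S.Ω ∘ e.symm) p.1) p.2 := by
  refine memSmoothIdeal_quadForm_covHessian (isSmoothMetricOn_htChart he) (x₀ := e S.Λ)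
    (contDiffOn_lam he) (fun x hx => S.lam_pos _ (symm_ne_Λ hx))
    (contDiffOn_comp_symm he S.Ω_smooth) (fun x _ => Ω_nonneg _)
    (fun x hx => S.Ω_pos _ (symm_ne_Λ hx)) (contDiffOn_comp_symm he hφ.1)
    (fun x hx => (hφ.sqrt_mul (symm_ne_Λ hx)).trans (geroch_eq_sinh (symm_ne_Λ hx)))
    fun y hy i j => ?_
  rw [← chartComponents_h]
  exact hvac e he y (spaceProj y) (fun _ => rfl) hy.1 (symm_ne_Λ hy) i.succ j.succ

theorem moment_hansen_eq_moment_geroch (hvac : S.IsVacuum) (hφ : S.IsRescaled S.hansen φ)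
    (hφ' : S.IsRescaled S.geroch φ') (he : e ∈ IsManifold.maximalAtlas (𝓡 3) ∞ Vt)
    (hΛ : S.Λ ∈ e.source) (n : ℕ) : S.moment φ e n = S.moment φ' e n := by
  obtain ⟨f, hf, hφφ'⟩ := exists_sub_eq_mul_Ω hφ hφ'
  have smooth {f : Vt → ℝ} (hf : ContMDiff (𝓡 3) 𝓘(ℝ, ℝ) ∞ f) := contDiffOn_comp_symm he hf
  have hΩ₀ : (S.Ω ∘ e.symm) (e S.Λ) = 0 := by
    rw [Function.comp_apply, e.left_inv hΛ, S.Ω_zero]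
  exact multipoleTensor_eq_of_sub_eq_mul (isSmoothMetricOn_htChart he) (smooth S.Ω_smooth)
    (smooth hf) (smooth hφ.1) (smooth hφ'.1) (fun x _ => hφφ' (e.symm x))
    (memSmoothIdeal_quadForm_covHessian_htChart hvac hφ' he) (e.map_source hΛ) hΩ₀
    (S.Ω_grad e he hΛ) n

end StaticAF

end Manifold

end Multipole

end

theorem mainTheorem5_general {Vt : Type*} [TopologicalSpace Vt]
    [ChartedSpace (EuclideanSpace ℝ (Fin 3)) Vt] [IsManifold (𝓡 3) ∞ Vt]
    (S : Multipole.StaticAF Vt) (hvac : S.IsVacuum) :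
    ((∃ φH, S.IsRescaled S.hansen φH) ↔ ∃ φG, S.IsRescaled S.geroch φG) ∧
    ∀ φH φG : Vt → ℝ, S.IsRescaled S.hansen φH → S.IsRescaled S.geroch φG →
      ∀ e ∈ IsManifold.maximalAtlas (𝓡 3) ∞ Vt, S.Λ ∈ e.source →
        ∀ n : ℕ, S.moment φH e n = S.moment φG e n :=
  ⟨⟨fun ⟨_, hφ⟩ => ⟨_, hφ.geroch_of_hansen⟩, fun ⟨_, hφ⟩ => ⟨_, hφ.hansen_of_geroch⟩⟩,
    fun _ _ hφH hφG _ he hΛ n =>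
      Multipole.StaticAF.moment_hansen_eq_moment_geroch hvac hφH hφG he hΛ n⟩

theorem mainTheorem5 {Vt : Type*} [TopologicalSpace Vt]
    [ChartedSpace (EuclideanSpace ℝ (Fin 3)) Vt] [IsManifold (𝓡 3) ∞ Vt]
    (S : Multipole.StaticAF Vt) (hvac : S.IsVacuum) (haxi : S.IsAxisymmetric) :
    ((∃ φH, S.IsRescaled S.hansen φH) ↔ ∃ φG, S.IsRescaled S.geroch φG) ∧
    ∀ φH φG : Vt → ℝ, S.IsRescaled S.hansen φH → S.IsRescaled S.geroch φG →
      ∀ e ∈ IsManifold.maximalAtlas (𝓡 3) ∞ Vt, S.Λ ∈ e.source →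
        ∀ n : ℕ, S.moment φH e n = S.moment φG e n :=
  mainTheorem5_general S hvac
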